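/- **Theorem 2.6 (two-matrix rectangular Cayley identity).** Let $0\le m\le n$ be integers, let $X=(x_{ij})$ and $Y=(y_{ij})$ be $m\times n$ matrices whose $2mn$ entries are distinct indeterminates, and let $\partial_X=(\partial/\partial x_{ij})$ and $\partial_Y=(\partial/\partial y_{ij})$ be the corresponding matrices of partial derivatives. Then $$\det(\partial_X\partial_Y^{\mathrm T})\,\det(XY^{\mathrm T})^s=\Bigl(\prod_{j=0}^{m-1}(s+j)(s+n-m+j)\Bigr)\det(XY^{\mathrm T})^{s-1}.$$ More generally, if $I,J\subseteq[m]=\{1,\dots,m\}$ with $|I|=|J|=k$, then $$\det[(\partial_X\partial_Y^{\mathrm T})_{IJ}]\,\det(XY^{\mathrm T})^s=\Bigl(\prod_{j=0}^{k-1}(s+j)(s+n-m+j)\Bigr)\det(XY^{\mathrm T})^{s-1}\,\epsilon(I,J)\,\det[(XY^{\mathrm T})_{I^cJ^c}].$$ Here $A_{IJ}$ is the submatrix of $A$ with rows $I$ and columns $J$ in their original order, $I^c=[m]\setminus I$, the determinant of the empty matrix is $1$, and $\epsilon(I,J)=\epsilon(I)\epsilon(J)$ with $\epsilon(I)=(-1)^{|I|(|I|-1)/2}(-1)^{\sum_{i\in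 I}i}$. Write $P=\det(XY^{\mathrm T})$. The identities hold in each of the following senses. 1. For every integer $s\ge1$, in the polynomial ring $R[X,Y]$ over any commutative ring $R$. 2. For every integer $s$, in the field of rational fractions $K(X,Y)$ over any field $K$. 3. Symbolically in $s$: for any field $K$ of characteristic $0$ and an indeterminate $s$, in the free rank-one module $K[X,Y,s,P^{-1}]\,P^s$, on which the partial derivatives act by $\partial(fP^s)=(\partial f+s f\,(\partial P)P^{-1})P^s$, and where $P^{s-1}=P^{-1}P^s$. 4. Analytically: for every $s\in\mathbb C$, every open set $U$ of pairs of real, or of pairs of complex, $m\times n$ matrices, and every branch $F$ of $P^s$ on $U$ (that is, $F:U\to\mathbb C$ is near each point of $U$ of the form $e^{sL}$ with $L$ continuous and $e^L=P$), at every point of $U$, where $P^{s-1}$ means $F/P$. In particular $F$ is infinitely differentiable on $U$ (in the real or the complex sense, respectively). -/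

import Mathlib

open scoped Matrix Topology

namespace RectCayley

/-! ### The variables and the matrices `X`, `Y`, `X Yᵀ` -/

/-- The `2 m n` variables: `Sum.inl (i, j)` is `x_{ij}` and `Sum.inr (i, j)` is `y_{ij}`. -/
abbrev Vars (m n : ℕ) : Type := (Fin m × Fin n) ⊕ (Fin m × Fin n)

/-- The matrix `X = (x_{ij})`, for given values `v` of the variables
(indeterminates, their images in a larger ring, or numbers). -/
def matX {A : Type*} {m n : ℕ} (v : Vars m n → A) : Matrix (Fin m) (Fin n) A :=
  Matrix.of fun i j => v (Sum.inl (i, j))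

/-- The matrix `Y = (y_{ij})`. -/
def matY {A : Type*} {m n : ℕ} (v : Vars m n → A) : Matrix (Fin m) (Fin n) A :=
  Matrix.of fun i j => v (Sum.inr (i, j))

/-- The `m × m` matrix `X Yᵀ`. -/
def matXY {A : Type*} [CommRing A] {m n : ℕ} (v : Vars m n → A) : Matrix (Fin m) (Fin m) A :=
  matX v * (matY v)ᵀ

/-! ### Minors and signs -/

/-- The submatrix `A_{IJ}` with rows `I` and columns `J`, kept in their original order. -/
def submat {A : Type*} {m k : ℕ} (B : Matrix (Fin m) (Fin m) A) (I J : Finset (Fin m))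
    (hI : I.card = k) (hJ : J.card = k) : Matrix (Fin k) (Fin k) A :=
  B.submatrix (I.orderEmbOfFin hI) (J.orderEmbOfFin hJ)

theorem card_compl_eq {m k : ℕ} {I : Finset (Fin m)} (hI : I.card = k) : Iᶜ.card = m - k := by
  rw [Finset.card_compl, Fintype.card_fin, hI]

/-- The submatrix `A_{Iᶜ Jᶜ}`. -/
def subCompl {A : Type*} {m k : ℕ} (B : Matrix (Fin m) (Fin m) A) (I J : Finset (Fin m))
    (hI : I.card = k) (hJ : J.card = k) : Matrix (Fin (m - k)) (Fin (m - k)) A :=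
  submat B Iᶜ Jᶜ (card_compl_eq hI) (card_compl_eq hJ)

/-- `ε(I) = (-1)^{|I|(|I|-1)/2} (-1)^{∑_{i ∈ I} i}`, where the elements of `I` are numbered
from `1` to `m`, so that the element `i : Fin m` has the number `i + 1`. -/
def eps {m : ℕ} (I : Finset (Fin m)) : ℤ :=
  (-1) ^ (I.card * (I.card - 1) / 2) * (-1) ^ (∑ i ∈ I, ((i : ℕ) + 1))

/-- `ε(I, J) = ε(I) ε(J)`. -/
def eps₂ {m : ℕ} (I J : Finset (Fin m)) : ℤ := eps I * eps J

/-- The factor `∏_{j=0}^{k-1} (s + j) (s + n - m + j)`. -/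
def factor {A : Type*} [CommRing A] (s : A) (m n k : ℕ) : A :=
  ∏ j ∈ Finset.range k, (s + (j : A)) * (s + (n : A) - (m : A) + (j : A))

/-! ### Determinants of matrices of operators -/

/-- The matrix `∂_X ∂_Yᵀ` of operators on `M`, where `D w` is the partial derivative with
respect to the variable `w`: the entry `(i, j)` is `∑_l (∂/∂x_{il}) (∂/∂y_{jl})`. -/
def opXY {M : Type*} [AddCommGroup M] {m n : ℕ} (D : Vars m n → M → M) :
    Matrix (Fin m) (Fin m) (M → M) :=
  Matrix.of fun i j f => ∑ l : Fin n, D (Sum.inl (i, l)) (D (Sum.inr (j, l)) f)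

/-- The determinant of a square matrix of (commuting) operators on `M`, applied to `f`:
`∑_π sgn(π) A_{π(0),0} (A_{π(1),1} (⋯ (A_{π(k-1),k-1} f)))`. -/
def opDet {M : Type*} [AddCommGroup M] {k : ℕ} (A : Matrix (Fin k) (Fin k) (M → M)) (f : M) : M :=
  ∑ π : Equiv.Perm (Fin k),
    (Equiv.Perm.sign π : ℤ) • (List.finRange k).foldr (fun i g => A (π i) i g) f

/-! ### Formal derivatives of fractions -/

/-- The extension of a derivation `d` of `A` to the ring of fractions `S⁻¹ A`,
given by the quotient rule `d (a / t) = (t * d a - a * d t) / t ^ 2`. -/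
noncomputable def fracDeriv {R A : Type*} [CommRing R] [CommRing A] [Algebra R A]
    (S : Submonoid A) (d : Derivation R A A) (f : Localization S) : Localization S :=
  Localization.liftOn f
    (fun a t => Localization.mk ((t : A) * d a - a * d (t : A)) (t * t))
    (by
      intro a b t u h
      obtain ⟨c, hc⟩ := Localization.r_iff_exists.1 h
      have hd := congrArg d hc
      simp only [Derivation.leibniz, smul_eq_mul] at hc hd
      refine Localization.mk_eq_mk_iff.2 (Localization.r_iff_exists.2 ⟨c * c, ?_⟩)
      push_cast
      linear_combination ((c : A) * t * u) * hd
        - ((t : A) * u * d (c : A) + c * u * d (t : A) + c * t * d (u : A)) * hc)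

/-! ### The formal symbol `P ^ s` with `s` an indeterminate

The coefficient ring of `MvPolynomial (Vars m n) (Polynomial K)` is `K[s]`, so this is the ring
`K[x, y, s]`. The free module of rank one `K[x, y, s, P⁻¹] P ^ s` has the elements `f P ^ s`
with `f` in `K[x, y, s, P⁻¹]`; such an element is represented by `f`. In particular `P ^ s` is
represented by `1`, and `P ^ (s - 1)` by `P⁻¹`. -/

/-- `P = det (X Yᵀ)` in `K[x, y, s]`. -/
noncomputable def symP (K : Type*) [Field K] (m n : ℕ) : MvPolynomial (Vars m n) (Polynomial K) :=
  (matXY MvPolynomial.X).det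

/-- The ring `K[x, y, s, P⁻¹]`. -/
abbrev SymRing (K : Type*) [Field K] (m n : ℕ) : Type _ := Localization.Away (symP K m n)

/-- The inclusion of `K[x, y, s]` in `K[x, y, s, P⁻¹]`. -/
noncomputable def toSym (K : Type*) [Field K] (m n : ℕ) :
    MvPolynomial (Vars m n) (Polynomial K) →+* SymRing K m n :=
  algebraMap _ _

/-- The indeterminate `s`. -/
noncomputable def symS (K : Type*) [Field K] (m n : ℕ) : SymRing K m n :=
  toSym K m n (MvPolynomial.C Polynomial.X)

/-- The element `P⁻¹`. -/
noncomputable def symPInv (K : Type*) [Field K] (m n : ℕ) : SymRing K m n :=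
  IsLocalization.Away.invSelf (symP K m n)

/-- Formal differentiation on `K[x, y, s, P⁻¹] P ^ s`:
`∂ (f P ^ s) = (∂ f + s f (∂ P) P⁻¹) P ^ s`, where `∂` is the derivative in the variable `w`. -/
noncomputable def symDeriv (K : Type*) [Field K] (m n : ℕ) (w : Vars m n) (f : SymRing K m n) :
    SymRing K m n :=
  fracDeriv (Submonoid.powers (symP K m n)) (MvPolynomial.pderiv w) f
    + symS K m n * f * toSym K m n (MvPolynomial.pderiv w (symP K m n)) * symPInv K m n

/-! ### Branches of complex powers and partial derivatives of functions -/

/-- `F` is a branch on `U` of the power `P ^ s` of the function `P`: near every point of `U` there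
is a continuous branch `L` of `log P` such that `F = exp (s L)`. -/
def IsPowBranch {E : Type*} [TopologicalSpace E] (P : E → ℂ) (s : ℂ) (U : Set E) (F : E → ℂ) :
    Prop :=
  ∀ x ∈ U, ∃ L : E → ℂ, ∀ᶠ y in 𝓝 x,
    ContinuousAt L y ∧ Complex.exp (L y) = P y ∧ F y = Complex.exp (s * L y)

/-- The partial derivative of a complex-valued function of the variables `Vars m n`, which range
over the field `𝕜` (the real or the complex numbers). -/
noncomputable def partialDeriv (𝕜 : Type*) [NontriviallyNormedField 𝕜] [NormedSpace 𝕜 ℂ]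
    {m n : ℕ} (w : Vars m n) (F : (Vars m n → 𝕜) → ℂ) : (Vars m n → 𝕜) → ℂ :=
  fun p => lineDeriv 𝕜 F p (Pi.single w 1)

end RectCayley

open RectCayley

namespace RectCayley

/-! ### Determinants of operators and of matrices -/

/-! Write `W` for the inverse transpose of `X Yᵀ` (`invT`) and `t = n - m`. Since `∂ (f P ^ s) = (∂
f + s f ∂P / P) P ^ s`, conjugation by `P ^ s` reduces every version of the identity to one about
the twisted operators `∂ + s ∂ log P` applied to `1`. The logarithmic gradients of `P` are `W Y` in
`X` and `(X Yᵀ)⁻¹ X` in `Y`. Each first derivative of `W` is a rank-one matrix, so on a minor of `W`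
an x-derivative replaces rows and a y-derivative replaces columns. Contracting over the column index
`l` of `X` and `Y` gives `W` again, and an entry of the twisted `∂_X ∂_Yᵀ` sends a minor of `W` to
an explicit combination of entries of `W` times minors with replaced columns (`opXY_det_invT`).

Expand the operator determinant along its first column and induct on its size. The column
replacements assemble into transpositions of the columns of a minor one size larger, and passing
from size `k` to `k + 1` costs the factor `s(s+t) + (2s+t)k + k² = (s+k)(s+t+k)`
(`sum_sign_capelli`). Hence the operator minor sends `1` to `factor` times `det W_{IJ}`
(`opDet_twistedDeriv`), and Jacobi's complementary minor identity (`det_mul_det_inv_submatrix`)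
rewrites `det W_{IJ}` as `P⁻¹ ε(I,J) det (X Yᵀ)_{IᶜJᶜ}`.

This calculation uses only derivations dual to the variables and an inverse of `P`. The symbolic
version is immediate. For integer `s`, multiplication by `P ^ s` undoes the twist in the fraction
field; for `s ≥ 1` the identity over `ℤ` descends to polynomials and then maps to any ring. For a
branch, rational functions times `F` model the formal module. -/

theorem opDet_succ {M : Type*} [AddCommGroup M] {k : ℕ}
    (B : Matrix (Fin (k + 1)) (Fin (k + 1)) (M → M))
    (hB : ∀ i j f g, B i j (f + g) = B i j f + B i j g) (f : M) :
    opDet B f = ∑ p, (if p = 0 then 1 else -1 : ℤ) •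
      B p 0 (opDet (B.submatrix (fun x => Equiv.swap 0 p x.succ) Fin.succ) f) := by
  have hsum : ∀ i j (t : Finset (Equiv.Perm (Fin k))) (z : Equiv.Perm (Fin k) → ℤ)
      (g : Equiv.Perm (Fin k) → M), B i j (∑ x ∈ t, z x • g x) = ∑ x ∈ t, z x • B i j (g x) := by
    intro i j t z g
    have := map_sum (AddMonoidHom.mk' (B i j) (hB i j)) (fun x => z x • g x) t
    simpa only [map_zsmul, AddMonoidHom.mk'_apply] using this
  unfold opDet
  -- Each permutation is uniquely a transposition `swap 0 p` after one fixing `0`, so the sign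
  -- depends only on whether `p = 0`. Column `0` acts outermost, so no commutativity is needed, only
  -- additivity of the entries.
  rw [Finset.univ_perm_fin_succ, ← Finset.univ_product_univ]
  simp only [Finset.sum_map, Finset.sum_product]
  refine Finset.sum_congr rfl fun p _ => ?_
  rw [hsum, Finset.smul_sum]
  refine Finset.sum_congr rfl fun σ _ => ?_
  rw [smul_smul]
  congr 1
  · simp only [Equiv.coe_toEmbedding, Equiv.Perm.decomposeFin.symm_sign]
    split_ifs <;> simp
  · simp only [List.finRange_succ, List.foldr_cons, List.foldr_map, Equiv.coe_toEmbedding,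
      Equiv.Perm.decomposeFin_symm_apply_zero, Equiv.Perm.decomposeFin_symm_apply_succ,
      Matrix.submatrix_apply]

theorem det_expand_swap {A : Type*} [CommRing A] {k : ℕ}
    (B : Matrix (Fin (k + 1)) (Fin (k + 1)) A) :
    B.det = ∑ p, (if p = 0 then 1 else -1 : ℤ) •
      (B p 0 * (B.submatrix (fun x => Equiv.swap 0 p x.succ) Fin.succ).det) := by
  rw [Matrix.det_apply, Finset.univ_perm_fin_succ, ← Finset.univ_product_univ]
  simp only [Finset.sum_map, Finset.sum_product]
  refine Finset.sum_congr rfl fun p _ => ?_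
  rw [Matrix.det_apply, Finset.mul_sum, Finset.smul_sum]
  refine Finset.sum_congr rfl fun σ _ => ?_
  simp only [Equiv.coe_toEmbedding, Equiv.Perm.decomposeFin.symm_sign, Fin.prod_univ_succ,
    Equiv.Perm.decomposeFin_symm_apply_zero, Equiv.Perm.decomposeFin_symm_apply_succ,
    Matrix.submatrix_apply, Units.smul_def, mul_smul_comm, smul_smul]
  split_ifs <;> simp

/-- Two families of operators that preserve a relation between two modules have
related determinants. -/
theorem opDet_rel {M N : Type*} [AddCommGroup M] [AddCommGroup N] (S : AddSubgroup (M × N))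
    {k : ℕ} (A : Matrix (Fin k) (Fin k) (M → M)) (B : Matrix (Fin k) (Fin k) (N → N))
    (h : ∀ i j x, x ∈ S → (A i j x.1, B i j x.2) ∈ S) {x : M × N} (hx : x ∈ S) :
    (opDet A x.1, opDet B x.2) ∈ S := by
  have key : ∀ (π : Equiv.Perm (Fin k)) (l : List (Fin k)),
      (l.foldr (fun i g => A (π i) i g) x.1, l.foldr (fun i g => B (π i) i g) x.2) ∈ S := by
    intro π l
    induction l with
    | nil => exact hx
    | cons i l ih => exact h _ _ _ ih
  have := S.sum_mem (t := Finset.univ) fun π _ =>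
    S.zsmul_mem (key π (List.finRange k)) (Equiv.Perm.sign π : ℤ)
  rw [← Prod.mk.eta (p := Finset.sum _ _), Prod.fst_sum, Prod.snd_sum] at this
  exact this

theorem opXY_rel {M N : Type*} [AddCommGroup M] [AddCommGroup N] (S : AddSubgroup (M × N))
    {m n : ℕ} (D : Vars m n → M → M) (D' : Vars m n → N → N)
    (h : ∀ w x, x ∈ S → (D w x.1, D' w x.2) ∈ S) (i j : Fin m) (x : M × N) (hx : x ∈ S) :
    (opXY D i j x.1, opXY D' i j x.2) ∈ S := by
  have := S.sum_mem (t := Finset.univ) fun (l : Fin n) _ =>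
    h (Sum.inl (i, l)) _ (h (Sum.inr (j, l)) _ hx)
  rw [← Prod.mk.eta (p := Finset.sum _ _), Prod.fst_sum, Prod.snd_sum] at this
  exact this

theorem opDet_opXY_rel {M N : Type*} [AddCommGroup M] [AddCommGroup N] (S : AddSubgroup (M × N))
    {m n k : ℕ} (D : Vars m n → M → M) (D' : Vars m n → N → N)
    (h : ∀ w x, x ∈ S → (D w x.1, D' w x.2) ∈ S) (r c : Fin k → Fin m) {x : M} {y : N}
    (hx : (x, y) ∈ S) :
    (opDet ((opXY D).submatrix r c) x, opDet ((opXY D').submatrix r c) y) ∈ S :=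
  opDet_rel S _ _ (fun i j => opXY_rel S D D' h (r i) (c j)) hx

/-- An additive map that intertwines two families of operators intertwines the determinants. -/
theorem opDet_opXY_map {M N : Type*} [AddCommGroup M] [AddCommGroup N] (φ : M →+ N)
    {m n k : ℕ} (D : Vars m n → M → M) (D' : Vars m n → N → N)
    (h : ∀ w x, φ (D w x) = D' w (φ x)) (r c : Fin k → Fin m) (x : M) :
    φ (opDet ((opXY D).submatrix r c) x) = opDet ((opXY D').submatrix r c) (φ x) := by
  -- Intertwining says exactly that the operators preserve the graph of `φ`.
  refine opDet_opXY_rel φ.graph D D' ?_ r c (x := x) (y := φ x)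
    (AddMonoidHom.mem_graph.2 rfl)
  rintro w ⟨a, b⟩ hab
  rw [AddMonoidHom.mem_graph] at hab ⊢
  simp only at hab ⊢
  rw [h, hab]

/-! ### Row and column replacement in minors -/

section Minors

variable {A : Type*}


theorem submatrix_update_row {m k : ℕ} (W : Matrix (Fin m) (Fin m) A) (r c : Fin k → Fin m)
    (α : Fin k) (a : Fin m) :
    W.submatrix (Function.update r α a) c = (W.submatrix r c).updateRow α fun j => W a (c j) := by
  ext i j
  by_cases h : i = α
  · subst h; simp
  · simp [h]

theorem submatrix_update_col {m k : ℕ} (W : Matrix (Fin m) (Fin m) A) (r c : Fin k → Fin m)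
    (β : Fin k) (e : Fin m) :
    W.submatrix r (Function.update c β e) = (W.submatrix r c).updateCol β fun i => W (r i) e := by
  ext i j
  by_cases h : j = β
  · subst h; simp
  · simp [h]

variable [CommRing A]

/-- By Cramer's rule both sides equal `v · adj(B) u`. -/
theorem sum_mul_det_updateRow {k : ℕ} (B : Matrix (Fin k) (Fin k) A) (u v : Fin k → A) :
    ∑ i, u i * (B.updateRow i v).det = ∑ j, v j * (B.updateCol j u).det := by
  have h1 : ∀ i, (B.updateRow i v).det = ∑ j, v j * B.adjugate j i := by
    intro i
    rw [← Matrix.cramer_transpose_apply, Matrix.cramer_eq_adjugate_mulVec,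
      ← Matrix.adjugate_transpose]
    simp only [Matrix.mulVec, dotProduct, Matrix.transpose_apply, mul_comm]
  have h2 : ∀ j, (B.updateCol j u).det = ∑ i, B.adjugate j i * u i := by
    intro j
    rw [← Matrix.cramer_apply, Matrix.cramer_eq_adjugate_mulVec]
    rfl
  simp only [h1, h2, Finset.mul_sum]
  rw [Finset.sum_comm]
  exact Finset.sum_congr rfl fun j _ => Finset.sum_congr rfl fun i _ => by ring

/-- Converts the row replacements produced by x-derivatives into the column replacements produced by
y-derivatives. -/
theorem sum_mul_det_update {m k : ℕ} (W : Matrix (Fin m) (Fin m) A) (r c : Fin k → Fin m)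
    (a e : Fin m) :
    ∑ α, W (r α) e * (W.submatrix (Function.update r α a) c).det =
      ∑ β, W a (c β) * (W.submatrix r (Function.update c β e)).det := by
  simp only [submatrix_update_row, submatrix_update_col]
  exact sum_mul_det_updateRow _ _ _

theorem det_submatrix_cons_swap {m k : ℕ} (W : Matrix (Fin m) (Fin m) A)
    (r : Fin (k + 1) → Fin m) (q : Fin k → Fin m) (e : Fin m) (γ : Fin k) :
    (W.submatrix r (Fin.cons (q γ) (Function.update q γ e))).det =
      -(W.submatrix r (Fin.cons e q)).det := by
  have h : W.submatrix r (Fin.cons (q γ) (Function.update q γ e) : Fin (k + 1) → Fin m) =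
      (W.submatrix r (Fin.cons e q : Fin (k + 1) → Fin m)).submatrix id
        (Equiv.swap 0 γ.succ) := by
    ext i j
    refine Fin.cases ?_ (fun j => ?_) j
    · simp only [Matrix.submatrix_apply, Fin.cons_zero, Equiv.swap_apply_left, Fin.cons_succ, id]
    · by_cases hj : j = γ
      · subst hj; simp
      · rw [Matrix.submatrix_apply, Matrix.submatrix_apply, Matrix.submatrix_apply,
          Equiv.swap_apply_of_ne_of_ne (Fin.succ_ne_zero j) (by simpa using hj)]
        simp [hj]
  rw [h, Matrix.det_permute', Equiv.Perm.sign_swap (Fin.succ_ne_zero γ).symm]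
  simp

theorem sum_sign_mul_det {m k : ℕ} (W : Matrix (Fin m) (Fin m) A) (r : Fin (k + 1) → Fin m)
    (q : Fin k → Fin m) (e : Fin m) :
    ∑ p, (if p = 0 then 1 else -1 : ℤ) •
      (W (r p) e * (W.submatrix (fun x => r (Equiv.swap 0 p x.succ)) q).det) =
      (W.submatrix r (Fin.cons e q)).det := by
  rw [det_expand_swap]
  rfl

/-- `E` stands for one operator entry applied to a minor, with `t = n - m` in the application. In
the signed sum over `p`, the leading term gives the large minor with coefficient `s(s+t)`. Each of
the `k` single replacements is one column transposition and gives minus the minor; each of the `k²`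
double replacements is two transpositions and gives plus the minor. -/
theorem sum_sign_capelli {m k : ℕ} (W : Matrix (Fin m) (Fin m) A) (r c : Fin (k + 1) → Fin m)
    (s t : A) (E : Fin m → Fin m → (Fin k → Fin m) → (Fin k → Fin m) → A)
    (hE : ∀ a e r c, E a e r c = s * (s + t) * (W a e * (W.submatrix r c).det)
      - (2 * s + t) * ∑ β, W a (c β) * (W.submatrix r (Function.update c β e)).det
      + ∑ β, ∑ γ, W a (Function.update c β e γ) *
        (W.submatrix r (Function.update (Function.update c β e) γ (c β))).det) :
    ∑ p, (if p = 0 then 1 else -1 : ℤ) •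
      E (r p) (c 0) (fun x => r (Equiv.swap 0 p x.succ)) (fun x => c x.succ) =
      (s + k) * (s + t + k) * (W.submatrix r c).det := by
  have hz : ∀ (z : ℤ) (a b x y w : A), z • (a * x - b * y + w) =
      a * (z • x) - b * (z • y) + z • w := by
    intro z a b x y w
    simp only [zsmul_eq_mul]
    ring
  simp only [hE, hz]
  simp only [Finset.sum_add_distrib, Finset.sum_sub_distrib, ← Finset.mul_sum]
  simp only [Finset.smul_sum]
  conv_lhs =>
    congr
    · right
      right
      rw [Finset.sum_comm]
    · rw [Finset.sum_comm]
  have hc : (Fin.cons (c 0) fun x => c x.succ : Fin (k + 1) → Fin m) = c := Fin.cons_self_tail c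
  have h1 : ∀ β : Fin k, ∑ p, (if p = 0 then 1 else -1 : ℤ) • (W (r p) (c β.succ) *
      (W.submatrix (fun x => r (Equiv.swap 0 p x.succ))
        (Function.update (fun x => c x.succ) β (c 0))).det) = -(W.submatrix r c).det := by
    intro β
    rw [sum_sign_mul_det, det_submatrix_cons_swap W r (fun x => c x.succ), hc]
  have h2 : ∀ β : Fin k, ∑ p, ∑ γ, (if p = 0 then 1 else -1 : ℤ) •
      (W (r p) (Function.update (fun x => c x.succ) β (c 0) γ) *
      (W.submatrix (fun x => r (Equiv.swap 0 p x.succ))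
        (Function.update (Function.update (fun x => c x.succ) β (c 0)) γ (c β.succ))).det) =
      k * (W.submatrix r c).det := by
    intro β
    rw [Finset.sum_comm]
    -- The first transposition undoes the replacement at `γ`, for `γ = β` as well; the next rewrite
    -- undoes the one at `β`.
    simp only [sum_sign_mul_det, det_submatrix_cons_swap, Finset.sum_const,
      Finset.card_univ, Fintype.card_fin, nsmul_eq_mul]
    rw [det_submatrix_cons_swap W r (fun x => c x.succ), hc, neg_neg]
  rw [Finset.sum_congr rfl fun β _ => h1 β, Finset.sum_congr rfl fun β _ => h2 β,
    sum_sign_mul_det, hc]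
  simp only [Finset.sum_const, Finset.card_univ, Fintype.card_fin, nsmul_eq_mul]
  ring

end Minors

/-! ### Derivatives of determinants and inverses -/

section Derivation

variable {A : Type*} [CommRing A] (d : Derivation ℤ A A)

theorem derivation_prod {ι : Type*} [DecidableEq ι] (t : Finset ι) (f : ι → A) :
    d (∏ i ∈ t, f i) = ∑ i ∈ t, (∏ j ∈ t.erase i, f j) * d (f i) := by
  induction t using Finset.induction_on with
  | empty => simp
  | insert a t ha ih =>
    rw [Finset.prod_insert ha, d.leibniz, ih, Finset.sum_insert ha, Finset.erase_insert ha,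
      smul_eq_mul, smul_eq_mul, Finset.mul_sum, add_comm]
    congr 1
    refine Finset.sum_congr rfl fun i hi => ?_
    have hia : a ≠ i := fun h => ha (h ▸ hi)
    rw [Finset.erase_insert_of_ne hia, Finset.prod_insert (fun h => ha (Finset.mem_of_mem_erase h)),
      mul_assoc]

theorem derivation_det {k : Type*} [DecidableEq k] [Fintype k] (B : Matrix k k A) :
    d B.det = ∑ j, (B.updateCol j fun i => d (B i j)).det := by
  simp only [Matrix.det_apply, map_sum, Units.smul_def, map_zsmul]
  rw [Finset.sum_comm]
  refine Finset.sum_congr rfl fun σ _ => ?_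
  rw [← Finset.smul_sum, derivation_prod]
  congr 1
  refine Finset.sum_congr rfl fun j _ => ?_
  rw [← Finset.prod_erase_mul _ _ (Finset.mem_univ j), Matrix.updateCol_self]
  congr 1
  refine Finset.prod_congr rfl fun i hi => ?_
  rw [Matrix.updateCol_ne (Finset.ne_of_mem_erase hi)]

theorem derivation_det_eq_trace {k : Type*} [DecidableEq k] [Fintype k] (B : Matrix k k A) :
    d B.det = (B.adjugate * B.map d).trace := by
  rw [derivation_det]
  refine Finset.sum_congr rfl fun j _ => ?_
  rw [← Matrix.cramer_apply, Matrix.cramer_eq_adjugate_mulVec]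
  rfl

theorem derivation_matrix_mul {k l o : Type*} [Fintype l] (B : Matrix k l A) (C : Matrix l o A) :
    (B * C).map d = B.map d * C + B * C.map d := by
  ext i j
  simp only [Matrix.map_apply, Matrix.mul_apply, map_sum, d.leibniz, smul_eq_mul, Matrix.add_apply,
    ← Finset.sum_add_distrib]
  exact Finset.sum_congr rfl fun l _ => by ring

/-- Differentiate `B⁻¹ B = 1` and multiply by `B⁻¹` on the right. -/
theorem derivation_inv {k : Type*} [DecidableEq k] [Fintype k] (B : Matrix k k A)
    (hB : IsUnit B.det) : (B⁻¹).map d = -(B⁻¹ * B.map d * B⁻¹) := by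
  have h1 : (B⁻¹ * B).map d = 0 := by
    rw [Matrix.nonsing_inv_mul _ hB]
    ext i j
    by_cases h : i = j <;> simp [h]
  rw [derivation_matrix_mul] at h1
  have h2 := congrArg (· * B⁻¹) h1
  simp only [Matrix.add_mul, Matrix.mul_assoc, Matrix.mul_nonsing_inv _ hB, Matrix.mul_one,
    Matrix.zero_mul] at h2
  rw [Matrix.mul_assoc]
  exact eq_neg_of_add_eq_zero_left h2

end Derivation

/-! ### Abstract form of the identity -/

section Abstract

variable {A : Type*} [CommRing A] {m n : ℕ}

/-- The derivative twisted by a formal power: `∂ (f P ^ s) = (∂ f + s f (∂ P) P⁻¹) P ^ s`. -/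
def twistedDeriv (d : Vars m n → Derivation ℤ A A) (P Pinv s : A) (w : Vars m n) (f : A) : A :=
  d w f + s * f * d w P * Pinv

variable (d : Vars m n → Derivation ℤ A A) (v : Vars m n → A)

/-- The matrix `(X Yᵀ)⁻ᵀ`. -/
noncomputable def invT (v : Vars m n → A) : Matrix (Fin m) (Fin m) A := ((matXY v)⁻¹)ᵀ

/-- The matrix `(X Yᵀ)⁻ᵀ Y`, the logarithmic gradient of `det (X Yᵀ)` in `X`. -/
noncomputable def gradX (v : Vars m n → A) : Matrix (Fin m) (Fin n) A := invT v * matY v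

/-- The matrix `(X Yᵀ)⁻¹ X`, the logarithmic gradient of `det (X Yᵀ)` in `Y`. -/
noncomputable def gradY (v : Vars m n → A) : Matrix (Fin m) (Fin n) A := (matXY v)⁻¹ * matX v

variable {d v} (hd : ∀ w w', d w (v w') = if w = w' then 1 else 0)

include hd

theorem deriv_inl_matXY (a : Fin m) (l : Fin n) (p q : Fin m) :
    d (Sum.inl (a, l)) (matXY v p q) = if p = a then matY v q l else 0 := by
  simp [matXY, matX, matY, Matrix.mul_apply, hd, Prod.ext_iff, ite_and, eq_comm]

theorem deriv_inr_matXY (e : Fin m) (l : Fin n) (p q : Fin m) :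
    d (Sum.inr (e, l)) (matXY v p q) = if q = e then matX v p l else 0 := by
  simp [matXY, matX, matY, Matrix.mul_apply, hd, Prod.ext_iff, ite_and, eq_comm]

variable (hP : IsUnit (matXY v).det)

include hP

/-- The derivative of `X Yᵀ` in `x_{al}` lives in row `a` only, so the derivative of the inverse has
rank one: row `p` of `W` becomes a multiple of row `a`. -/
theorem deriv_inl_invT (a : Fin m) (l : Fin n) (p q : Fin m) :
    d (Sum.inl (a, l)) (invT v p q) = -(gradX v p l * invT v a q) := by
  have h := congrFun (congrFun (derivation_inv (d (Sum.inl (a, l))) (matXY v) hP) q) p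
  simp only [Matrix.map_apply, Matrix.neg_apply, Matrix.mul_apply, deriv_inl_matXY hd,
    mul_ite, mul_zero, Finset.sum_ite_eq', Finset.mem_univ, if_true] at h
  rw [invT, Matrix.transpose_apply, h, gradX, Matrix.mul_apply, Finset.sum_mul]
  congr 1
  refine Finset.sum_congr rfl fun i _ => ?_
  rw [invT, Matrix.transpose_apply, Matrix.transpose_apply]
  ring

theorem deriv_inr_invT (e : Fin m) (l : Fin n) (p q : Fin m) :
    d (Sum.inr (e, l)) (invT v p q) = -(gradY v q l * invT v p e) := by
  have h := congrFun (congrFun (derivation_inv (d (Sum.inr (e, l))) (matXY v) hP) q) p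
  simp only [Matrix.map_apply, Matrix.neg_apply, Matrix.mul_apply, deriv_inr_matXY hd,
    mul_ite, mul_zero, Finset.sum_ite_irrel, Finset.sum_const_zero, ite_mul, zero_mul,
    Finset.sum_ite_eq', Finset.mem_univ, if_true] at h
  rw [invT, Matrix.transpose_apply, h, gradY, Matrix.mul_apply, Matrix.transpose_apply]

theorem deriv_inl_det (a : Fin m) (l : Fin n) :
    d (Sum.inl (a, l)) (matXY v).det = (matXY v).det * gradX v a l := by
  have h : (matXY v).adjugate = (matXY v).det • (matXY v)⁻¹ := by
    rw [Matrix.inv_def, smul_smul, Ring.mul_inverse_cancel _ hP, one_smul]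
  rw [derivation_det_eq_trace, h, Matrix.smul_mul, Matrix.trace_smul, smul_eq_mul]
  congr 1
  simp [Matrix.trace, Matrix.mul_apply, deriv_inl_matXY hd, gradX, invT]

theorem deriv_inr_det (e : Fin m) (l : Fin n) :
    d (Sum.inr (e, l)) (matXY v).det = (matXY v).det * gradY v e l := by
  have h : (matXY v).adjugate = (matXY v).det • (matXY v)⁻¹ := by
    rw [Matrix.inv_def, smul_smul, Ring.mul_inverse_cancel _ hP, one_smul]
  rw [derivation_det_eq_trace, h, Matrix.smul_mul, Matrix.trace_smul, smul_eq_mul]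
  congr 1
  simp [Matrix.trace, Matrix.mul_apply, deriv_inr_matXY hd, gradY, Finset.sum_ite_irrel]

omit hd in
-- `Y Xᵀ` is the transpose of `X Yᵀ`, so it cancels one of the two inverses.
theorem sum_gradX_mul_gradY (p q : Fin m) :
    ∑ l, gradX v p l * gradY v q l = invT v p q := by
  have h : gradX v * (gradY v)ᵀ = invT v := by
    have h2 : matY v * (matX v)ᵀ = (matXY v)ᵀ := by
      rw [matXY, Matrix.transpose_mul, Matrix.transpose_transpose]
    rw [gradX, gradY, Matrix.transpose_mul, Matrix.mul_assoc, ← Matrix.mul_assoc (matY v), h2, invT,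
      ← Matrix.transpose_mul, Matrix.nonsing_inv_mul _ hP, Matrix.transpose_one, Matrix.mul_one]
  rw [← h]
  rfl

omit hd in
theorem sum_gradX_mul_matX : ∑ l, ∑ p, gradX v p l * matX v p l = (m : A) := by
  rw [Finset.sum_comm]
  have h : gradX v * (matX v)ᵀ = 1 := by
    have h2 : matY v * (matX v)ᵀ = (matXY v)ᵀ := by
      rw [matXY, Matrix.transpose_mul, Matrix.transpose_transpose]
    rw [gradX, Matrix.mul_assoc, h2, invT,
      ← Matrix.transpose_mul, Matrix.mul_nonsing_inv _ hP, Matrix.transpose_one]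
  have := congrArg Matrix.trace h
  simpa [Matrix.trace, Matrix.mul_apply] using this

/-- The source of `n - m`. Differentiating the factor `X` of `(X Yᵀ)⁻¹ X` contributes once for each
of the `n` values of `l`; differentiating the inverse contributes minus the trace of `W Y Xᵀ = 1`,
which is `m`. -/
theorem sum_deriv_inl_gradY (a q : Fin m) :
    ∑ l, d (Sum.inl (a, l)) (gradY v q l) = ((n : A) - m) * invT v a q := by
  have h1 : ∀ l p, d (Sum.inl (a, l)) ((matXY v)⁻¹ q p) = -(gradX v p l * invT v a q) :=
    fun l p => deriv_inl_invT hd hP a l p q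
  have h2 : ∀ l p, d (Sum.inl (a, l)) (matX v p l) = if a = p then 1 else 0 := by
    intro l p
    simp [matX, hd]
  simp only [gradY, Matrix.mul_apply, map_sum, Derivation.leibniz, smul_eq_mul, h1, h2,
    Finset.sum_add_distrib, mul_ite, mul_one, mul_zero, Finset.sum_ite_eq, Finset.mem_univ, if_true,
    Finset.sum_const, Finset.card_univ, Fintype.card_fin, nsmul_eq_mul, mul_neg,
    Finset.sum_neg_distrib]
  rw [sub_mul, ← sum_gradX_mul_matX hP, Finset.sum_mul, sub_eq_add_neg, invT,
    Matrix.transpose_apply]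
  congr 2
  exact Finset.sum_congr rfl fun l _ => by
    rw [Finset.sum_mul]; exact Finset.sum_congr rfl fun p _ => by ring

theorem deriv_inr_det_invT {k : ℕ} (e : Fin m) (l : Fin n) (r c : Fin k → Fin m) :
    d (Sum.inr (e, l)) ((invT v).submatrix r c).det =
      -∑ β, gradY v (c β) l * ((invT v).submatrix r (Function.update c β e)).det := by
  rw [derivation_det, ← Finset.sum_neg_distrib]
  refine Finset.sum_congr rfl fun β _ => ?_
  simp only [Matrix.submatrix_apply, deriv_inr_invT hd hP, submatrix_update_col]
  rw [← neg_mul, ← Matrix.det_updateCol_smul]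
  congr 2
  ext i
  simp

theorem deriv_inl_det_invT {k : ℕ} (a : Fin m) (l : Fin n) (r c : Fin k → Fin m) :
    d (Sum.inl (a, l)) ((invT v).submatrix r c).det =
      -∑ β, gradX v (r β) l * ((invT v).submatrix (Function.update r β a) c).det := by
  rw [← Matrix.det_transpose, derivation_det, ← Finset.sum_neg_distrib]
  refine Finset.sum_congr rfl fun β _ => ?_
  simp only [Matrix.transpose_apply, Matrix.submatrix_apply, deriv_inl_invT hd hP,
    submatrix_update_row]
  rw [← neg_mul, ← Matrix.det_updateRow_smul, ← Matrix.det_transpose, Matrix.updateCol_transpose,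
    Matrix.transpose_transpose]
  congr 2
  ext i
  simp

variable {s Pinv : A} (hs : ∀ w, d w s = 0) (hPinv : (matXY v).det * Pinv = 1)

include hPinv

theorem twistedDeriv_inl (a : Fin m) (l : Fin n) (f : A) :
    twistedDeriv d (matXY v).det Pinv s (Sum.inl (a, l)) f =
      d (Sum.inl (a, l)) f + s * gradX v a l * f := by
  rw [twistedDeriv, deriv_inl_det hd hP]
  linear_combination s * f * gradX v a l * hPinv

theorem twistedDeriv_inr (e : Fin m) (l : Fin n) (f : A) :
    twistedDeriv d (matXY v).det Pinv s (Sum.inr (e, l)) f =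
      d (Sum.inr (e, l)) f + s * gradY v e l * f := by
  rw [twistedDeriv, deriv_inr_det hd hP]
  linear_combination s * f * gradY v e l * hPinv

include hs

theorem opXY_det_invT {k : ℕ} (a e : Fin m) (r c : Fin k → Fin m) :
    opXY (twistedDeriv d (matXY v).det Pinv s) a e ((invT v).submatrix r c).det =
      s * (s + ((n : A) - m)) * (invT v a e * ((invT v).submatrix r c).det)
      - (2 * s + ((n : A) - m)) *
        ∑ β, invT v a (c β) * ((invT v).submatrix r (Function.update c β e)).det
      + ∑ β, ∑ γ, invT v a (Function.update c β e γ) *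
        ((invT v).submatrix r (Function.update (Function.update c β e) γ (c β))).det := by
  have hg := sum_gradX_mul_gradY hP
  have hg' := fun q => sum_deriv_inl_gradY hd hP a q
  -- The derivative of `gradY` supplies `n - m`, the twist supplies `s`, and the derivative of the
  -- minor supplies row replacements, which `sum_mul_det_update` turns into column replacements.
  -- Used for `(e, c)` and for each `(c β, update c β e)`, it yields the coefficient `s + (s + n -
  -- m)` of the single replacements.
  have hfirst : ∀ (q : Fin m) (c' : Fin k → Fin m),
      ∑ l, twistedDeriv d (matXY v).det Pinv s (Sum.inl (a, l))
        (gradY v q l * ((invT v).submatrix r c').det) =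
      (s + ((n : A) - m)) * (invT v a q * ((invT v).submatrix r c').det) -
        ∑ β, invT v a (c' β) * ((invT v).submatrix r (Function.update c' β q)).det := by
    intro q c'
    have : ∀ l, twistedDeriv d (matXY v).det Pinv s (Sum.inl (a, l))
        (gradY v q l * ((invT v).submatrix r c').det) =
        d (Sum.inl (a, l)) (gradY v q l) * ((invT v).submatrix r c').det +
        s * ((gradX v a l * gradY v q l) * ((invT v).submatrix r c').det) -
        ∑ α, (gradX v (r α) l * gradY v q l) *
          ((invT v).submatrix (Function.update r α a) c').det := by
      intro l
      rw [twistedDeriv_inl hd hP hPinv, Derivation.leibniz, deriv_inl_det_invT hd hP, smul_eq_mul,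
        smul_eq_mul, mul_neg, Finset.mul_sum]
      have : ∑ α, gradY v q l * (gradX v (r α) l *
          ((invT v).submatrix (Function.update r α a) c').det) =
          ∑ α, gradX v (r α) l * gradY v q l *
          ((invT v).submatrix (Function.update r α a) c').det :=
        Finset.sum_congr rfl fun α _ => by ring
      rw [this]
      ring
    simp only [this, Finset.sum_sub_distrib, Finset.sum_add_distrib]
    rw [Finset.sum_comm]
    simp only [← Finset.mul_sum, ← Finset.sum_mul, hg, hg']
    rw [sum_mul_det_update]
    ring
  have hsecond : ∀ l, twistedDeriv d (matXY v).det Pinv s (Sum.inr (e, l))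
      ((invT v).submatrix r c).det = s * (gradY v e l * ((invT v).submatrix r c).det) -
        ∑ β, gradY v (c β) l * ((invT v).submatrix r (Function.update c β e)).det := by
    intro l
    rw [twistedDeriv_inr hd hP hPinv, deriv_inr_det_invT hd hP]
    ring
  have hlin : ∀ l (x : A) (y : Fin k → A),
      twistedDeriv d (matXY v).det Pinv s (Sum.inl (a, l)) (s * x - ∑ β, y β) =
      s * twistedDeriv d (matXY v).det Pinv s (Sum.inl (a, l)) x -
        ∑ β, twistedDeriv d (matXY v).det Pinv s (Sum.inl (a, l)) (y β) := by
    intro l x y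
    simp only [twistedDeriv, map_sub, map_sum, Derivation.leibniz, hs, smul_eq_mul,
      Finset.sum_add_distrib, ← Finset.sum_mul, ← Finset.mul_sum]
    ring
  simp only [opXY, Matrix.of_apply, hsecond, hlin, Finset.sum_sub_distrib, ← Finset.mul_sum]
  rw [Finset.sum_comm]
  simp only [hfirst, Finset.sum_sub_distrib, ← Finset.mul_sum]
  ring

/-- The index maps `r`, `c` are arbitrary because the expansion along the first column leaves the
remaining rows out of order. -/
theorem opDet_twistedDeriv {k : ℕ} (r c : Fin k → Fin m) :
    opDet ((opXY (twistedDeriv d (matXY v).det Pinv s)).submatrix r c) 1 =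
      factor s m n k * ((invT v).submatrix r c).det := by
  induction k with
  | zero => simp [opDet, factor]
  | succ k ih =>
    have hadd : ∀ w (f g : A), twistedDeriv d (matXY v).det Pinv s w (f + g) =
        twistedDeriv d (matXY v).det Pinv s w f + twistedDeriv d (matXY v).det Pinv s w g := by
      intro w f g
      simp only [twistedDeriv, map_add]
      ring
    -- The factor from the induction hypothesis involves only `s` and integers, so it passes through
    -- the next operator.
    have hconst : ∀ k' : ℕ, ∀ w, d w (factor s m n k') = 0 := by
      intro k' w
      simp [factor, derivation_prod, hs]
    have hmul : ∀ w (f : A), twistedDeriv d (matXY v).det Pinv s w (factor s m n k * f) =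
        factor s m n k * twistedDeriv d (matXY v).det Pinv s w f := by
      intro w f
      simp only [twistedDeriv, Derivation.leibniz, hconst, smul_eq_mul]
      ring
    rw [opDet_succ _ (fun i j f g => by
      simp only [Matrix.submatrix_apply, opXY, Matrix.of_apply, hadd, Finset.sum_add_distrib])]
    simp only [Matrix.submatrix_submatrix, ih, Matrix.submatrix_apply]
    have hmul' : ∀ a e (f : A), opXY (twistedDeriv d (matXY v).det Pinv s) a e
        (factor s m n k * f) = factor s m n k *
          opXY (twistedDeriv d (matXY v).det Pinv s) a e f := by
      intro a e f
      simp only [opXY, Matrix.of_apply, hmul, Finset.mul_sum]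
    simp only [hmul', ← mul_smul_comm, ← Finset.mul_sum]
    have := sum_sign_capelli (invT v) r c s ((n : A) - m)
      (fun a e r c => opXY (twistedDeriv d (matXY v).det Pinv s) a e
        ((invT v).submatrix r c).det) (fun a e r c => opXY_det_invT hd hP hs hPinv a e r c)
    simp only [Function.comp_def]
    rw [this, factor, factor, Finset.prod_range_succ]
    ring

end Abstract

/-! ### Complementary minors -/

/-- Multiplying `B` by the first block column of `C`, completed by `0` and `1` to a block triangular
matrix, gives a block triangular matrix with diagonal blocks `1` and `B₂₂`. Take determinants. -/
theorem det_mul_det_toBlocks₁₁_eq {A : Type*} [CommRing A] {k l : Type*} [Fintype k] [Fintype l]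
    [DecidableEq k] [DecidableEq l] {B C : Matrix (k ⊕ l) (k ⊕ l) A} (h : B * C = 1) :
    B.det * C.toBlocks₁₁.det = B.toBlocks₂₂.det := by
  have h1 : B.toBlocks₁₁ * C.toBlocks₁₁ + B.toBlocks₁₂ * C.toBlocks₂₁ = 1 := by
    have := congrArg Matrix.toBlocks₁₁ h
    rw [← B.fromBlocks_toBlocks, ← C.fromBlocks_toBlocks, Matrix.fromBlocks_multiply,
      ← Matrix.fromBlocks_one] at this
    simpa only [Matrix.toBlocks_fromBlocks₁₁] using this
  have h2 : B.toBlocks₂₁ * C.toBlocks₁₁ + B.toBlocks₂₂ * C.toBlocks₂₁ = 0 := by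
    have := congrArg Matrix.toBlocks₂₁ h
    rw [← B.fromBlocks_toBlocks, ← C.fromBlocks_toBlocks, Matrix.fromBlocks_multiply,
      ← Matrix.fromBlocks_one] at this
    simpa only [Matrix.toBlocks_fromBlocks₂₁] using this
  have h3 : B * Matrix.fromBlocks C.toBlocks₁₁ 0 C.toBlocks₂₁ 1 =
      Matrix.fromBlocks 1 B.toBlocks₁₂ 0 B.toBlocks₂₂ := by
    conv_lhs => rw [← B.fromBlocks_toBlocks]
    rw [Matrix.fromBlocks_multiply, h1, h2]
    simp
  have := congrArg Matrix.det h3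
  rwa [Matrix.det_mul, Matrix.det_fromBlocks_zero₁₂, Matrix.det_fromBlocks_zero₂₁, Matrix.det_one,
    Matrix.det_one, mul_one, one_mul] at this

theorem prod_orderEmbOfFin {M : Type*} [CommMonoid M] {m k : ℕ} (I : Finset (Fin m))
    (hI : I.card = k) (f : Fin m → M) : ∏ a : Fin k, f (I.orderEmbOfFin hI a) = ∏ i ∈ I, f i := by
  conv_rhs => rw [← Finset.image_orderEmbOfFin_univ I hI]
  rw [Finset.prod_image fun _ _ _ _ h => (I.orderEmbOfFin hI).injective h]

theorem card_filter_lt_orderEmbOfFin {m k : ℕ} (I : Finset (Fin m)) (hI : I.card = k)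
    (a : Fin k) : (I.filter (· < I.orderEmbOfFin hI a)).card = a := by
  have : I.filter (· < I.orderEmbOfFin hI a) =
      (Finset.Iio a).map (I.orderEmbOfFin hI).toEmbedding := by
    ext i
    rw [Finset.mem_filter, ← Finset.mem_coe, ← Finset.range_orderEmbOfFin I hI]
    simp only [Set.mem_range, Finset.mem_map, Finset.mem_Iio]
    constructor
    · rintro ⟨⟨b, rfl⟩, hb⟩
      exact ⟨b, (I.orderEmbOfFin hI).lt_iff_lt.1 hb, rfl⟩
    · rintro ⟨b, hb, rfl⟩
      exact ⟨⟨b, rfl⟩, (I.orderEmbOfFin hI).lt_iff_lt.2 hb⟩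
  rw [this, Finset.card_map, Fin.card_Iio]

/-- An element `a` of `I` lies above `a` indices in all; those outside `I` are counted by
subtracting those in `I`, whose numbers run through `0, …, k-1` and sum to `k(k-1)/2`. The sign
`(-1)^k` compensates for `eps` numbering from `1`. -/
theorem prod_inversions {m k : ℕ} (I : Finset (Fin m)) (hI : I.card = k) :
    ∏ a ∈ I, ∏ b ∈ Iᶜ, (if a < b then 1 else -1 : ℤ) = (-1) ^ k * eps I := by
  have h1 : ∀ a ∈ I, ∏ b ∈ Iᶜ, (if a < b then 1 else -1 : ℤ) =
      (-1) ^ (I.filter (· < a)).card * (-1) ^ (a : ℕ) := by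
    intro a ha
    have h2 : ∏ b ∈ Iᶜ, (if a < b then 1 else -1 : ℤ) = (-1) ^ (Iᶜ.filter (· < a)).card := by
      rw [← Finset.prod_const, Finset.prod_filter]
      refine Finset.prod_congr rfl fun b hb => ?_
      have hab : a ≠ b := fun h => Finset.mem_compl.1 hb (h ▸ ha)
      rcases lt_or_gt_of_ne hab with h | h
      · simp [h, h.le]
      · simp [h, h.le]
    have h3 : (I.filter (· < a)).card + (Iᶜ.filter (· < a)).card = a := by
      rw [← Finset.card_union_of_disjoint
        (Finset.disjoint_filter_filter disjoint_compl_right), ← Finset.filter_union,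
        Finset.union_compl, show Finset.univ.filter (· < a) = Finset.Iio a by ext; simp,
        Fin.card_Iio]
    have h4 := congrArg (fun t => (-1 : ℤ) ^ t) h3
    simp only [pow_add] at h4
    rw [h2, ← h4, ← mul_assoc, ← mul_pow]
    simp only [mul_neg_one, neg_neg, one_pow, one_mul]
  rw [Finset.prod_congr rfl h1, Finset.prod_mul_distrib,
    ← prod_orderEmbOfFin I hI fun a => (-1 : ℤ) ^ (I.filter (· < a)).card]
  simp only [card_filter_lt_orderEmbOfFin]
  rw [Finset.prod_pow_eq_pow_sum, Finset.prod_pow_eq_pow_sum,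
    Fin.sum_univ_eq_sum_range (fun i => i),
    Finset.sum_range_id, eps, Finset.sum_add_distrib, pow_add, hI]
  simp only [Finset.sum_const, smul_eq_mul, mul_one, hI]
  have : ((-1 : ℤ) ^ k) * (-1) ^ k = 1 := by rw [← mul_pow]; simp
  linear_combination -(-1 : ℤ) ^ (k * (k - 1) / 2) * (-1) ^ (∑ i ∈ I, (i : ℕ)) * this

/-- The permutation lists `I` and then `Iᶜ`, each increasingly, so its inversions are the pairs `b <
a` with `a ∈ I` and `b ∉ I`. -/
theorem sign_finSumEquivOfFinset {k l : ℕ} (I : Finset (Fin (k + l))) (hI : I.card = k)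
    (hI' : Iᶜ.card = l) :
    (Equiv.Perm.sign (finSumFinEquiv.symm.trans (finSumEquivOfFinset hI hI')) : ℤ) =
      (-1) ^ k * eps I := by
  rw [← prod_inversions I hI, Equiv.Perm.sign_eq_prod_prod_Iio]
  simp only [Units.coe_prod, apply_ite Units.val, Units.val_one, Units.val_neg]
  have hIio : ∀ (j : Fin (k + l)) (f : Fin (k + l) → ℤ),
      ∏ i ∈ Finset.Iio j, f i = ∏ i, if i < j then f i else 1 := by
    intro j f
    rw [← Finset.prod_filter]
    congr 1
    ext
    simp
  simp only [hIio, Fin.prod_univ_add]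
  simp only [Equiv.trans_apply, finSumFinEquiv_symm_apply_castAdd,
    finSumFinEquiv_symm_apply_natAdd, finSumEquivOfFinset_inl, finSumEquivOfFinset_inr,
    OrderEmbedding.lt_iff_lt]
  have hlt : ∀ (a : Fin k) (b : Fin l), Fin.castAdd l a < Fin.natAdd k b := by
    intro a b
    rw [Fin.lt_def]
    simp
    omega
  have hle : ∀ (a : Fin k) (b : Fin l), ¬ Fin.natAdd k b < Fin.castAdd l a :=
    fun a b => (hlt a b).le.not_gt
  have h1 : ∀ a a' : Fin k, (if Fin.castAdd l a < Fin.castAdd l a' then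
      (if a < a' then 1 else -1 : ℤ) else 1) = 1 := by
    intro a a'
    by_cases h : a < a' <;> simp [h, Fin.lt_def]
  have h2 : ∀ b b' : Fin l, (if Fin.natAdd k b < Fin.natAdd k b' then
      (if b < b' then 1 else -1 : ℤ) else 1) = 1 := by
    intro b b'
    by_cases h : b < b' <;> simp [h, Fin.lt_def]
  simp only [h1, h2, hlt, hle, if_true, if_false, Finset.prod_const_one, mul_one, one_mul]
  rw [Finset.prod_comm, ← prod_orderEmbOfFin I hI]
  exact Finset.prod_congr rfl fun a _ => prod_orderEmbOfFin Iᶜ hI'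
    fun b => if I.orderEmbOfFin hI a < b then (1 : ℤ) else -1

/-- Jacobi's identity for complementary minors. -/
theorem det_mul_det_inv_submatrix {A : Type*} [CommRing A] {m k l : ℕ} (h : k + l = m)
    (B : Matrix (Fin m) (Fin m) A) (hB : IsUnit B.det) (I J : Finset (Fin m))
    (hI : I.card = k) (hJ : J.card = k) (hI' : Iᶜ.card = l) (hJ' : Jᶜ.card = l) :
    B.det * (submat (B⁻¹)ᵀ I J hI hJ).det = (eps₂ I J : ℤ) * (submat B Iᶜ Jᶜ hI' hJ').det := by
  subst h
  set eI := finSumEquivOfFinset hI hI'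
  set eJ := finSumEquivOfFinset hJ hJ'
  have hmul : B.submatrix eI eJ * (B⁻¹).submatrix eJ eI = 1 := by
    rw [Matrix.submatrix_mul_equiv, Matrix.mul_nonsing_inv _ hB, Matrix.submatrix_one_equiv]
  have hdet : (B.submatrix eI eJ).det = (eps₂ I J : ℤ) * B.det := by
    have : B.submatrix eI eJ = ((B.submatrix id (finSumFinEquiv.symm.trans eJ)).submatrix
        (finSumFinEquiv.symm.trans eI) id).submatrix finSumFinEquiv finSumFinEquiv := by
      ext i j
      simp
    rw [this, Matrix.det_submatrix_equiv_self, Matrix.det_permute, Matrix.det_permute',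
      sign_finSumEquivOfFinset, sign_finSumEquivOfFinset, eps₂]
    push_cast
    -- The signs `(-1)^k` from sorting rows and columns cancel because `|I| = |J|`.
    have : ((-1 : A) ^ k) * (-1) ^ k = 1 := by rw [← mul_pow]; simp
    linear_combination (eps I : A) * (eps J : A) * B.det * this
  have key := det_mul_det_toBlocks₁₁_eq hmul
  have h11 : ((B⁻¹).submatrix eJ eI).toBlocks₁₁ = (submat (B⁻¹)ᵀ I J hI hJ)ᵀ := by
    ext i j
    simp [Matrix.toBlocks₁₁, submat, eI, eJ, finSumEquivOfFinset_inl]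
  have h22 : (B.submatrix eI eJ).toBlocks₂₂ = submat B Iᶜ Jᶜ hI' hJ' := by
    ext i j
    simp [Matrix.toBlocks₂₂, submat, eI, eJ, finSumEquivOfFinset_inr]
  rw [hdet, h11, h22, Matrix.det_transpose] at key
  have hsq : ((eps₂ I J : ℤ) : A) * (eps₂ I J : ℤ) = 1 := by
    rw [← Int.cast_mul, ← Int.cast_one]
    congr 1
    simp only [eps₂, eps, mul_mul_mul_comm _ _ (_ : ℤ), ← mul_pow, mul_neg_one, neg_neg, one_pow,
      mul_one]
  rw [← key]
  linear_combination -B.det * (submat (B⁻¹)ᵀ I J hI hJ).det * hsq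

theorem card_le_of_card_eq {m k : ℕ} {I : Finset (Fin m)} (hI : I.card = k) : k ≤ m := by
  simpa [hI] using I.card_le_univ

theorem det_submat_invT {A : Type*} [CommRing A] {m n k : ℕ} (v : Vars m n → A) {Pinv : A}
    (hPinv : (matXY v).det * Pinv = 1) (I J : Finset (Fin m)) (hI : I.card = k) (hJ : J.card = k) :
    (submat (invT v) I J hI hJ).det =
      Pinv * ((eps₂ I J : ℤ) * (subCompl (matXY v) I J hI hJ).det) := by
  have := det_mul_det_inv_submatrix (Nat.add_sub_cancel' (card_le_of_card_eq hI)) (matXY v)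
    (IsUnit.of_mul_eq_one _ hPinv) I J hI hJ (card_compl_eq hI) (card_compl_eq hJ)
  rw [subCompl, ← this, invT]
  linear_combination -(submat ((matXY v)⁻¹)ᵀ I J hI hJ).det * hPinv

theorem submat_univ {A : Type*} {m : ℕ} (B : Matrix (Fin m) (Fin m) A) :
    submat B Finset.univ Finset.univ (Finset.card_fin m) (Finset.card_fin m) = B := by
  have h : ∀ i, (Finset.univ : Finset (Fin m)).orderEmbOfFin (Finset.card_fin m) i = i := by
    intro i
    have := Finset.orderEmbOfFin_unique (Finset.card_fin m) (f := id) (fun _ => Finset.mem_univ _)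
      strictMono_id
    exact (congrFun this i).symm
  ext i j
  simp [submat, h]

/-- For `I = J = [m]` the sign is a square and the complementary minor is empty; this makes the full
determinant a special case. -/
theorem eps₂_mul_det_subCompl_univ {A : Type*} [CommRing A] {m : ℕ} (B : Matrix (Fin m) (Fin m) A) :
    ((eps₂ (Finset.univ : Finset (Fin m)) Finset.univ : ℤ) : A) *
      (subCompl B Finset.univ Finset.univ (Finset.card_fin m) (Finset.card_fin m)).det = 1 := by
  have h : IsEmpty (Fin (m - m)) := by rw [Nat.sub_self]; infer_instance
  rw [Matrix.det_isEmpty, mul_one, ← Int.cast_one]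
  congr 1
  simp only [eps₂, eps, mul_mul_mul_comm _ _ (_ : ℤ), ← mul_pow, mul_neg_one, neg_neg, one_pow,
    mul_one]

/-- The identity for formal powers, in a commutative ring with derivations dual to the variables. -/
theorem opDet_submat_twistedDeriv {A : Type*} [CommRing A] {m n k : ℕ}
    {d : Vars m n → Derivation ℤ A A} {v : Vars m n → A}
    (hd : ∀ w w', d w (v w') = if w = w' then 1 else 0) {s Pinv : A} (hs : ∀ w, d w s = 0)
    (hPinv : (matXY v).det * Pinv = 1) (I J : Finset (Fin m)) (hI : I.card = k) (hJ : J.card = k) :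
    opDet (submat (opXY (twistedDeriv d (matXY v).det Pinv s)) I J hI hJ) 1 =
      factor s m n k * Pinv * ((eps₂ I J : ℤ) * (subCompl (matXY v) I J hI hJ).det) := by
  rw [mul_assoc, ← det_submat_invT v hPinv]
  exact opDet_twistedDeriv hd (IsUnit.of_mul_eq_one _ hPinv) hs hPinv _ _

/-! ### Compatibility with ring homomorphisms -/

section Map

variable {A B : Type*} [CommRing A] [CommRing B] (f : A →+* B) {m n k : ℕ}

theorem map_factor (s : A) : f (factor s m n k) = factor (f s) m n k := by
  simp [factor, map_prod]

theorem map_matXY (v : Vars m n → A) : (matXY v).map f = matXY fun w => f (v w) := by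
  ext i j
  simp [matXY, matX, matY, Matrix.mul_apply]

theorem map_det_matXY (v : Vars m n → A) : f (matXY v).det = (matXY fun w => f (v w)).det := by
  rw [f.map_det, RingHom.mapMatrix_apply, map_matXY]

theorem map_det_subCompl (v : Vars m n → A) (I J : Finset (Fin m)) (hI : I.card = k)
    (hJ : J.card = k) :
    f (subCompl (matXY v) I J hI hJ).det =
      (subCompl (matXY fun w => f (v w)) I J hI hJ).det := by
  rw [f.map_det, RingHom.mapMatrix_apply, ← map_matXY]
  rfl

end Map

/-- Specialise both `X` and `Y` to the identity matrix padded with zero columns, which exists since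
`m ≤ n`. -/
theorem det_matXY_X_ne_zero (R : Type*) [CommRing R] [Nontrivial R] {m n : ℕ} (hmn : m ≤ n) :
    (matXY (MvPolynomial.X : Vars m n → MvPolynomial (Vars m n) R)).det ≠ 0 := by
  intro h
  let u : Vars m n → R :=
    Sum.elim (fun p => if Fin.castLE hmn p.1 = p.2 then 1 else 0)
      (fun p => if Fin.castLE hmn p.1 = p.2 then 1 else 0)
  have h1 := congrArg (MvPolynomial.eval u) h
  rw [map_det_matXY, map_zero] at h1
  have h2 : (matXY fun w => MvPolynomial.eval u (MvPolynomial.X w)) = 1 := by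
    ext i j
    simp [matXY, matX, matY, Matrix.mul_apply, u, Matrix.one_apply, eq_comm]
  rw [h2, Matrix.det_one] at h1
  exact one_ne_zero h1

/-! ### Derivations of fractions -/

/-- An additive map that satisfies the Leibniz rule, as a derivation. -/
def derivationOfLeibniz {B : Type*} [CommRing B] (f : B → B) (hadd : ∀ a b, f (a + b) = f a + f b)
    (hmul : ∀ a b, f (a * b) = a * f b + b * f a) : Derivation ℤ B B :=
  Derivation.mk' (AddMonoidHom.mk' f hadd).toIntLinearMap hmul

section Frac

variable {R A : Type*} [CommRing R] [CommRing A] [Algebra R A] (S : Submonoid A)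
  (d : Derivation R A A)

theorem fracDeriv_mk (a : A) (t : S) :
    fracDeriv S d (Localization.mk a t) =
      Localization.mk ((t : A) * d a - a * d (t : A)) (t * t) :=
  rfl

theorem fracDeriv_algebraMap (a : A) :
    fracDeriv S d (algebraMap A (Localization S) a) = algebraMap A (Localization S) (d a) := by
  rw [← Localization.mk_one_eq_algebraMap, ← Localization.mk_one_eq_algebraMap, fracDeriv_mk]
  simp

theorem fracDeriv_add (f g : Localization S) :
    fracDeriv S d (f + g) = fracDeriv S d f + fracDeriv S d g := by
  induction f using Localization.induction_on with | _ p =>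
  induction g using Localization.induction_on with | _ q =>
  obtain ⟨a, t⟩ := p
  obtain ⟨b, u⟩ := q
  simp only [Localization.add_mk, fracDeriv_mk]
  refine Localization.mk_eq_mk_iff.2 (Localization.r_iff_exists.2 ⟨1, ?_⟩)
  simp only [Submonoid.coe_mul, map_add, Derivation.leibniz, smul_eq_mul]
  ring

theorem fracDeriv_mul (f g : Localization S) :
    fracDeriv S d (f * g) = f * fracDeriv S d g + g * fracDeriv S d f := by
  induction f using Localization.induction_on with | _ p =>
  induction g using Localization.induction_on with | _ q =>
  obtain ⟨a, t⟩ := p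
  obtain ⟨b, u⟩ := q
  simp only [Localization.mk_mul, Localization.add_mk, fracDeriv_mk]
  refine Localization.mk_eq_mk_iff.2 (Localization.r_iff_exists.2 ⟨1, ?_⟩)
  simp only [Submonoid.coe_mul, Derivation.leibniz, smul_eq_mul]
  ring

end Frac

theorem fracDeriv_pderiv_X {R : Type*} [CommRing R] {m n : ℕ}
    (S : Submonoid (MvPolynomial (Vars m n) R)) (w w' : Vars m n) :
    fracDeriv S (MvPolynomial.pderiv w)
        (algebraMap (MvPolynomial (Vars m n) R) (Localization S) (MvPolynomial.X w')) =
      if w = w' then 1 else 0 := by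
  rw [fracDeriv_algebraMap, MvPolynomial.pderiv_X]
  by_cases h : w = w'
  · subst h; simp
  · simp [h, Ne.symm h]

/-! ### Integer exponents -/

/-- The identity for integer exponents in a field with derivations. -/
theorem opDet_zpow_of_derivation {F : Type*} [Field F] {m n k : ℕ}
    {d : Vars m n → Derivation ℤ F F} {v : Vars m n → F}
    (hd : ∀ w w', d w (v w') = if w = w' then 1 else 0) (hP : (matXY v).det ≠ 0) (s : ℤ)
    (I J : Finset (Fin m)) (hI : I.card = k) (hJ : J.card = k) :
    opDet (submat (opXY fun w => d w) I J hI hJ) ((matXY v).det ^ s) =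
      factor (s : F) m n k * (matXY v).det ^ (s - 1) *
        ((eps₂ I J : ℤ) * (subCompl (matXY v) I J hI hJ).det) := by
  have key := opDet_submat_twistedDeriv (d := d) (s := (s : F)) hd
    (fun w => (d w).map_intCast s) (mul_inv_cancel₀ hP) I J hI hJ
  -- Multiplication by `P ^ s` carries the twisted derivative to the plain one, and `1` to `P ^ s`.
  have hmap := opDet_opXY_map (AddMonoidHom.mulLeft ((matXY v).det ^ s))
    (twistedDeriv d (matXY v).det (matXY v).det⁻¹ (s : F)) (fun w => d w) (fun w f => by
      simp only [AddMonoidHom.coe_mulLeft, twistedDeriv]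
      rw [Derivation.leibniz, Derivation.leibniz_zpow, zpow_sub_one₀ hP]
      simp only [smul_eq_mul, zsmul_eq_mul]
      ring) (I.orderEmbOfFin hI) (J.orderEmbOfFin hJ) 1
  rw [AddMonoidHom.coe_mulLeft, mul_one] at hmap
  refine hmap.symm.trans ((congrArg ((matXY v).det ^ s * ·) key).trans ?_)
  simp only [zpow_sub_one₀ hP]
  ring

theorem opDet_zpow_of_leibniz {F : Type*} [Field F] {m n k : ℕ} {D : Vars m n → F → F}
    (hadd : ∀ w f g, D w (f + g) = D w f + D w g)
    (hmul : ∀ w f g, D w (f * g) = f * D w g + g * D w f) {v : Vars m n → F}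
    (hD : ∀ w w', D w (v w') = if w = w' then 1 else 0) (hP : (matXY v).det ≠ 0) (s : ℤ)
    (I J : Finset (Fin m)) (hI : I.card = k) (hJ : J.card = k) :
    opDet (submat (opXY D) I J hI hJ) ((matXY v).det ^ s) =
      factor (s : F) m n k * (matXY v).det ^ (s - 1) *
        ((eps₂ I J : ℤ) * (subCompl (matXY v) I J hI hJ).det) :=
  opDet_zpow_of_derivation (d := fun w => derivationOfLeibniz (D w) (hadd w) (hmul w)) hD hP s
    I J hI hJ

/-- The identity for integer exponents over a field of fractions. -/
theorem opDet_zpow (R : Type*) [CommRing R] [IsDomain R] {m n k : ℕ} (hmn : m ≤ n) (s : ℤ)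
    (I J : Finset (Fin m)) (hI : I.card = k) (hJ : J.card = k) :
    let F := FractionRing (MvPolynomial (Vars m n) R)
    let D : Vars m n → F → F :=
      fun w => fracDeriv (nonZeroDivisors (MvPolynomial (Vars m n) R)) (MvPolynomial.pderiv w)
    let Z : Matrix (Fin m) (Fin m) F :=
      matXY fun w => algebraMap (MvPolynomial (Vars m n) R) F (MvPolynomial.X w)
    opDet (submat (opXY D) I J hI hJ) (Z.det ^ s) =
      factor (s : F) m n k * Z.det ^ (s - 1) *
        ((eps₂ I J : ℤ) * (subCompl Z I J hI hJ).det) := by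
  intro F D Z
  have hP : Z.det ≠ 0 := by
    rw [← map_det_matXY]
    exact (map_ne_zero_iff _ (IsFractionRing.injective (MvPolynomial (Vars m n) R) F)).2
      (det_matXY_X_ne_zero R hmn)
  have hadd : ∀ w f g, D w (f + g) = D w f + D w g := fun w => fracDeriv_add _ _
  have hmul : ∀ w f g, D w (f * g) = f * D w g + g * D w f := fun w => fracDeriv_mul _ _
  have hD : ∀ w w', D w (algebraMap (MvPolynomial (Vars m n) R) F (MvPolynomial.X w')) =
      if w = w' then 1 else 0 := fun w w' => fracDeriv_pderiv_X _ w w'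
  exact opDet_zpow_of_leibniz hadd hmul hD hP s I J hI hJ

/-- The identity for positive integer exponents over the integers. -/
theorem opDet_pow_int {m n k : ℕ} (hmn : m ≤ n) (s : ℕ) (hs : 1 ≤ s)
    (I J : Finset (Fin m)) (hI : I.card = k) (hJ : J.card = k) :
    let D : Vars m n → MvPolynomial (Vars m n) ℤ → MvPolynomial (Vars m n) ℤ :=
      fun w f => MvPolynomial.pderiv w f
    let Z : Matrix (Fin m) (Fin m) (MvPolynomial (Vars m n) ℤ) := matXY MvPolynomial.X
    opDet (submat (opXY D) I J hI hJ) (Z.det ^ s) =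
      factor (s : MvPolynomial (Vars m n) ℤ) m n k * Z.det ^ (s - 1) *
        ((eps₂ I J : ℤ) * (subCompl Z I J hI hJ).det) := by
  intro D Z
  let F := FractionRing (MvPolynomial (Vars m n) ℤ)
  apply IsFractionRing.injective (MvPolynomial (Vars m n) ℤ) F
  have key := opDet_zpow ℤ hmn (s : ℤ) I J hI hJ
  have hmap := opDet_opXY_map (algebraMap (MvPolynomial (Vars m n) ℤ) F).toAddMonoidHom D
    (fun w => fracDeriv (nonZeroDivisors (MvPolynomial (Vars m n) ℤ)) (MvPolynomial.pderiv w))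
    (fun w f => (fracDeriv_algebraMap _ _ f).symm) (I.orderEmbOfFin hI) (J.orderEmbOfFin hJ)
    (Z.det ^ s)
  refine hmap.trans ?_
  change opDet _ (algebraMap (MvPolynomial (Vars m n) ℤ) F (Z.det ^ s)) = _
  simp only [map_mul, map_pow, map_factor, map_natCast, map_intCast]
  rw [map_det_matXY, map_det_subCompl]
  -- Here `1 ≤ s` makes the truncated difference agree with the integer one.
  have hs' : (s : ℤ) - 1 = ((s - 1 : ℕ) : ℤ) := by omega
  simp only [hs', zpow_natCast, Int.cast_natCast] at key
  exact key

/-- The identity for positive integer exponents over an arbitrary commutative ring. -/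
theorem opDet_pow (R : Type*) [CommRing R] {m n k : ℕ} (hmn : m ≤ n) (s : ℕ) (hs : 1 ≤ s)
    (I J : Finset (Fin m)) (hI : I.card = k) (hJ : J.card = k) :
    let D : Vars m n → MvPolynomial (Vars m n) R → MvPolynomial (Vars m n) R :=
      fun w f => MvPolynomial.pderiv w f
    let Z : Matrix (Fin m) (Fin m) (MvPolynomial (Vars m n) R) := matXY MvPolynomial.X
    opDet (submat (opXY D) I J hI hJ) (Z.det ^ s) =
      factor (s : MvPolynomial (Vars m n) R) m n k * Z.det ^ (s - 1) *
        ((eps₂ I J : ℤ) * (subCompl Z I J hI hJ).det) := by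
  intro D Z
  -- The coefficients of the identity are integers, so it survives base change to `R`, which may
  -- have zero divisors.
  let φ : MvPolynomial (Vars m n) ℤ →+* MvPolynomial (Vars m n) R :=
    MvPolynomial.map (Int.castRingHom R)
  have hX : (fun w => φ (MvPolynomial.X w)) = (MvPolynomial.X : Vars m n → _) := by
    funext w
    exact MvPolynomial.map_X _ _
  have key := congrArg φ (opDet_pow_int hmn s hs I J hI hJ)
  have hmap := opDet_opXY_map φ.toAddMonoidHom
    (fun w f => MvPolynomial.pderiv w f) D (fun w f => MvPolynomial.pderiv_map.symm)
    (I.orderEmbOfFin hI) (J.orderEmbOfFin hJ) ((matXY MvPolynomial.X).det ^ s)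
  have hmap' := hmap.symm.trans key
  change opDet _ (φ ((matXY MvPolynomial.X).det ^ s)) = _ at hmap'
  simp only [map_mul, map_pow, map_factor, map_natCast, map_intCast] at hmap'
  rw [map_det_matXY, map_det_subCompl, hX] at hmap'
  exact hmap'

/-! ### Symbolic exponents -/

theorem opDet_submat_formalPow {A : Type*} [CommRing A] {m n k : ℕ} {D : Vars m n → A → A}
    (hadd : ∀ w f g, D w (f + g) = D w f + D w g)
    (hmul : ∀ w f g, D w (f * g) = f * D w g + g * D w f) {v : Vars m n → A}
    (hD : ∀ w w', D w (v w') = if w = w' then 1 else 0) {s Pinv : A} (hs : ∀ w, D w s = 0)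
    (hPinv : (matXY v).det * Pinv = 1) (I J : Finset (Fin m)) (hI : I.card = k) (hJ : J.card = k) :
    opDet (submat (opXY fun w f => D w f + s * f * D w (matXY v).det * Pinv) I J hI hJ) 1 =
      factor s m n k * Pinv * ((eps₂ I J : ℤ) * (subCompl (matXY v) I J hI hJ).det) :=
  opDet_submat_twistedDeriv (d := fun w => derivationOfLeibniz (D w) (hadd w) (hmul w)) hD hs
    hPinv I J hI hJ

theorem toSym_symP (K : Type*) [Field K] (m n : ℕ) :
    toSym K m n (symP K m n) = (matXY fun w => toSym K m n (MvPolynomial.X w)).det :=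
  map_det_matXY _ _

/-- The identity for an indeterminate exponent. -/
theorem opDet_symDeriv (K : Type*) [Field K] {m n k : ℕ}
    (I J : Finset (Fin m)) (hI : I.card = k) (hJ : J.card = k) :
    opDet (submat (opXY (symDeriv K m n)) I J hI hJ) 1 =
      factor (symS K m n) m n k * symPInv K m n * ((eps₂ I J : ℤ) *
        (subCompl (matXY fun w => toSym K m n (MvPolynomial.X w)) I J hI hJ).det) := by
  let D : Vars m n → SymRing K m n → SymRing K m n := fun w =>
    fracDeriv (Submonoid.powers (symP K m n)) (MvPolynomial.pderiv w)
  have hadd : ∀ w f g, D w (f + g) = D w f + D w g := fun w => fracDeriv_add _ _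
  have hmul : ∀ w f g, D w (f * g) = f * D w g + g * D w f := fun w => fracDeriv_mul _ _
  have hX : ∀ w w', D w (toSym K m n (MvPolynomial.X w')) = if w = w' then 1 else 0 :=
    fun w w' => fracDeriv_pderiv_X _ w w'
  have hs : ∀ w, D w (symS K m n) = 0 := by
    intro w
    refine (fracDeriv_algebraMap _ _ _).trans ?_
    rw [MvPolynomial.pderiv_C, map_zero]
  have hPinv : (matXY fun w => toSym K m n (MvPolynomial.X w)).det * symPInv K m n = 1 := by
    rw [← toSym_symP]
    exact IsLocalization.Away.mul_invSelf _
  have hD : symDeriv K m n = fun w f => D w f + symS K m n * f *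
      D w (matXY fun w => toSym K m n (MvPolynomial.X w)).det * symPInv K m n := by
    funext w f
    rw [symDeriv, ← toSym_symP]
    congr 3
    exact (fracDeriv_algebraMap _ _ _).symm
  rw [hD]
  exact opDet_submat_formalPow hadd hmul hX hs hPinv I J hI hJ

/-! ### Branches of complex powers -/

/-- Near each point, a branch of a power of `P` is a holomorphic function of `P`. -/
theorem IsPowBranch.exists_eventuallyEq_comp {E : Type*} [TopologicalSpace E] {P : E → ℂ} {s : ℂ}
    {U : Set E} {F : E → ℂ} (hF : IsPowBranch P s U F) {x : E} (hx : x ∈ U) :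
    P x ≠ 0 ∧ ∃ h : ℂ → ℂ, ContDiffAt ℂ (⊤ : ℕ∞) h (P x) ∧
      HasDerivAt h (s * F x / P x) (P x) ∧ F =ᶠ[𝓝 x] fun y => h (P y) := by
  obtain ⟨L, hL⟩ := hF x hx
  obtain ⟨hcont, hexp, hFx⟩ := hL.self_of_nhds
  have hPx : P x ≠ 0 := hexp ▸ Complex.exp_ne_zero _
  have hslit : P x / P x ∈ Complex.slitPlane := by
    rw [div_self hPx]
    exact Complex.one_mem_slitPlane
  -- Dividing by `P x` moves the base point to `1`, where the principal logarithm is holomorphic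
  -- whatever `P x` is.
  refine ⟨hPx, fun z => Complex.exp (s * (L x + Complex.log (z / P x))), ?_, ?_, ?_⟩
  · have h1 : ContDiffAt ℂ (⊤ : ℕ∞) (fun z => Complex.log (z / P x)) (P x) :=
      ContDiffAt.comp (g := Complex.log) (f := fun z => z / P x) (P x)
        (Complex.contDiffAt_log hslit) (contDiffAt_id.div_const (P x))
    exact (contDiffAt_const.mul (contDiffAt_const.add h1)).cexp
  · have h1 : HasDerivAt (fun z => Complex.log (z / P x)) (1 / P x / (P x / P x)) (P x) :=
      ((hasDerivAt_id (P x)).div_const (P x)).clog hslit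
    have h2 := ((h1.const_add (L x)).const_mul s).cexp
    refine h2.congr_deriv ?_
    rw [div_self hPx, Complex.log_one, add_zero, ← hFx]
    ring
  -- Once `|L y - L x| < π`, the principal logarithm of `exp (L y - L x)` is `L y - L x` itself,
  -- with no multiple of `2πi`.
  · have hnear : ∀ᶠ y in 𝓝 x, ‖L y - L x‖ < Real.pi := by
      have : Filter.Tendsto (fun y => ‖L y - L x‖) (𝓝 x) (𝓝 0) := by
        have := (hcont.sub (continuousAt_const (y := L x))).norm
        simpa [ContinuousAt] using this
      exact this.eventually (gt_mem_nhds Real.pi_pos)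
    filter_upwards [hL, hnear] with y hy hlt
    have him := abs_lt.1 ((Complex.abs_im_le_norm _).trans_lt hlt)
    rw [hy.2.2, ← hy.2.1, ← hexp, ← Complex.exp_sub, Complex.log_exp him.1 him.2.le,
      add_sub_cancel]

/-! ### From formal to analytic derivatives, over real or complex variables -/

section Analytic

variable {𝕜 : Type*} [NontriviallyNormedField 𝕜] [NormedAlgebra 𝕜 ℂ] {m n : ℕ}

/-- The complex coordinates of a point with coordinates in `𝕜`. -/
noncomputable def complexCoords (p : Vars m n → 𝕜) : Vars m n → ℂ := fun w => algebraMap 𝕜 ℂ (p w)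

theorem contDiff_eval (a : MvPolynomial (Vars m n) ℂ) :
    ContDiff 𝕜 (⊤ : ℕ∞) fun p : Vars m n → 𝕜 => MvPolynomial.eval (complexCoords p) a := by
  induction a using MvPolynomial.induction_on with
  | C a => simpa using contDiff_const
  | add a b ha hb => simpa using ha.add hb
  | mul_X a w ha =>
    simp only [map_mul, MvPolynomial.eval_X, complexCoords]
    exact ha.mul ((algebraMapCLM 𝕜 ℂ).contDiff.comp (contDiff_apply 𝕜 𝕜 w))

theorem hasDerivAt_eval (p : Vars m n → 𝕜) (w : Vars m n) (a : MvPolynomial (Vars m n) ℂ) :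
    HasDerivAt (fun t : 𝕜 => MvPolynomial.eval (complexCoords (p + t • Pi.single w 1)) a)
      (MvPolynomial.eval (complexCoords p) (MvPolynomial.pderiv w a)) 0 := by
  induction a using MvPolynomial.induction_on with
  | C a => simpa using hasDerivAt_const (0 : 𝕜) a
  | add a b ha hb => simpa using ha.fun_add hb
  | mul_X a w' ha =>
    have hX : HasDerivAt (fun t : 𝕜 => complexCoords (p + t • Pi.single w 1) w')
        (MvPolynomial.eval (complexCoords p) (MvPolynomial.pderiv w (MvPolynomial.X w'))) 0 := by
      have h1 : HasDerivAt (fun t : 𝕜 => p w' + t * (Pi.single w 1 : Vars m n → 𝕜) w')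
          ((Pi.single w 1 : Vars m n → 𝕜) w') 0 := by
        simpa using ((hasDerivAt_id (0 : 𝕜)).mul_const _).const_add (p w')
      have h2 := (algebraMapCLM 𝕜 ℂ).hasFDerivAt.comp_hasDerivAt (0 : 𝕜) h1
      refine h2.congr_deriv ?_
      rw [MvPolynomial.pderiv_X]
      by_cases h : w = w'
      · subst h; simp
      · simp [Ne.symm h]
    simp only [map_mul, MvPolynomial.eval_X, Derivation.leibniz, smul_eq_mul, map_add]
    refine (ha.mul hX).congr_deriv ?_
    simp only [zero_smul, add_zero]
    ring

/-- `det (X Yᵀ)` as a polynomial with complex coefficients. -/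
noncomputable def detPoly (m n : ℕ) : MvPolynomial (Vars m n) ℂ := (matXY MvPolynomial.X).det

theorem eval_detPoly (q : Vars m n → ℂ) :
    MvPolynomial.eval q (detPoly m n) = (matXY q).det := by
  rw [detPoly, map_det_matXY]
  simp only [MvPolynomial.eval_X]

/-- Evaluation of rational functions with denominator a power of `det (X Yᵀ)`. -/
noncomputable def evalFrac (q : Vars m n → ℂ) (hq : (matXY q).det ≠ 0) :
    Localization.Away (detPoly m n) →+* ℂ :=
  IsLocalization.Away.lift (detPoly m n) (g := MvPolynomial.eval q)
    (by rw [eval_detPoly]; exact hq.isUnit)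

theorem evalFrac_algebraMap (q : Vars m n → ℂ) (hq : (matXY q).det ≠ 0)
    (a : MvPolynomial (Vars m n) ℂ) :
    evalFrac q hq (algebraMap _ _ a) = MvPolynomial.eval q a :=
  IsLocalization.Away.lift_eq _ _ _

theorem eval_powers_ne_zero {q : Vars m n → ℂ} (hq : (matXY q).det ≠ 0)
    (t : Submonoid.powers (detPoly m n)) : MvPolynomial.eval q (t : MvPolynomial _ ℂ) ≠ 0 := by
  obtain ⟨_, k, rfl⟩ := t
  simp only [map_pow, eval_detPoly]
  exact pow_ne_zero _ hq

theorem evalFrac_mk (q : Vars m n → ℂ) (hq : (matXY q).det ≠ 0)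
    (a : MvPolynomial (Vars m n) ℂ) (t : Submonoid.powers (detPoly m n)) :
    evalFrac q hq (Localization.mk a t) = MvPolynomial.eval q a / MvPolynomial.eval q t := by
  rw [eq_div_iff (eval_powers_ne_zero hq t), ← evalFrac_algebraMap q hq, ← map_mul,
    ← Localization.mk_one_eq_algebraMap, Localization.mk_mul, ← evalFrac_algebraMap q hq,
    ← Localization.mk_one_eq_algebraMap]
  congr 1
  refine Localization.mk_eq_mk_iff.2 (Localization.r_iff_exists.2 ⟨1, ?_⟩)
  simp
  ring

variable {U : Set (Vars m n → 𝕜)} {F : (Vars m n → 𝕜) → ℂ} {s : ℂ}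

theorem hasDerivAt_frac {p : Vars m n → 𝕜} (hp : (matXY (complexCoords p)).det ≠ 0) (w : Vars m n)
    (a : MvPolynomial (Vars m n) ℂ) (t : Submonoid.powers (detPoly m n)) :
    HasDerivAt (fun z : 𝕜 => MvPolynomial.eval (complexCoords (p + z • Pi.single w 1)) a /
        MvPolynomial.eval (complexCoords (p + z • Pi.single w 1)) (t : MvPolynomial _ ℂ))
      (evalFrac (complexCoords p) hp (fracDeriv (Submonoid.powers (detPoly m n))
        (MvPolynomial.pderiv w) (Localization.mk a t))) 0 := by
  have h0 := eval_powers_ne_zero hp t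
  have := (hasDerivAt_eval p w a).div (hasDerivAt_eval p w (t : MvPolynomial _ ℂ))
    (by simpa using h0)
  refine this.congr_deriv ?_
  simp only [fracDeriv_mk, evalFrac_mk, zero_smul, add_zero, map_sub, map_mul, Submonoid.coe_mul]
  ring

theorem IsPowBranch.hasDerivAt_line
    (hF : IsPowBranch (fun p => (matXY (complexCoords p)).det) s U F) {p : Vars m n → 𝕜}
    (hp : p ∈ U) (w : Vars m n) :
    HasDerivAt (fun z : 𝕜 => F (p + z • Pi.single w 1))
      (s * F p / (matXY (complexCoords p)).det *
        MvPolynomial.eval (complexCoords p) (MvPolynomial.pderiv w (detPoly m n))) 0 := by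
  obtain ⟨-, h, -, hh, heq⟩ := hF.exists_eventuallyEq_comp hp
  have hline : Filter.Tendsto (fun z : 𝕜 => p + z • Pi.single w (1 : 𝕜)) (𝓝 0) (𝓝 p) := by
    have : Continuous fun z : 𝕜 => p + z • (Pi.single w (1 : 𝕜) : Vars m n → 𝕜) := by fun_prop
    simpa using this.tendsto 0
  have h1 := hasDerivAt_eval p w (detPoly m n)
  simp only [eval_detPoly] at h1
  refine HasDerivAt.congr_of_eventuallyEq ?_ (hline.eventually heq)
  refine HasDerivAt.comp (h₂ := h) (0 : 𝕜) ?_ h1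
  simpa using hh

/-- The functions `f F` on `U`, where `f` is a rational function. -/
def fracMulRel (hU : ∀ p ∈ U, (matXY (complexCoords p)).det ≠ 0) (F : (Vars m n → 𝕜) → ℂ) :
    AddSubgroup (Localization.Away (detPoly m n) × ((Vars m n → 𝕜) → ℂ)) where
  carrier := {x | ∀ p (hp : p ∈ U), x.2 p = evalFrac (complexCoords p) (hU p hp) x.1 * F p}
  zero_mem' p hp := by simp
  add_mem' {x y} hx hy p hp := by simp [hx p hp, hy p hp, add_mul]
  neg_mem' {x} hx p hp := by simp [hx p hp]

theorem mem_fracMulRel {hU : ∀ p ∈ U, (matXY (complexCoords p)).det ≠ 0}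
    {F : (Vars m n → 𝕜) → ℂ} {f : Localization.Away (detPoly m n)} {g : (Vars m n → 𝕜) → ℂ} :
    (f, g) ∈ fracMulRel hU F ↔
      ∀ p (hp : p ∈ U), g p = evalFrac (complexCoords p) (hU p hp) f * F p :=
  Iff.rfl

/-- Differentiation of `f P ^ s` on formal powers and on branches. -/
theorem partialDeriv_mem_fracMulRel (hUo : IsOpen U)
    (hF : IsPowBranch (fun p => (matXY (complexCoords p)).det) s U F)
    (hU : ∀ p ∈ U, (matXY (complexCoords p)).det ≠ 0) (w : Vars m n)
    {f : Localization.Away (detPoly m n)} {g : (Vars m n → 𝕜) → ℂ}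
    (hfg : (f, g) ∈ fracMulRel hU F) :
    (fracDeriv (Submonoid.powers (detPoly m n)) (MvPolynomial.pderiv w) f +
        algebraMap (MvPolynomial (Vars m n) ℂ) _ (MvPolynomial.C s) * f *
          fracDeriv (Submonoid.powers (detPoly m n)) (MvPolynomial.pderiv w)
            (algebraMap (MvPolynomial (Vars m n) ℂ) _ (detPoly m n)) *
          IsLocalization.Away.invSelf (detPoly m n), partialDeriv 𝕜 w g) ∈ fracMulRel hU F := by
  rw [mem_fracMulRel] at hfg ⊢
  intro p hp
  have hline : Filter.Tendsto (fun z : 𝕜 => p + z • Pi.single w (1 : 𝕜)) (𝓝 0) (𝓝 p) := by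
    have : Continuous fun z : 𝕜 => p + z • (Pi.single w (1 : 𝕜) : Vars m n → 𝕜) := by fun_prop
    simpa using this.tendsto 0
  have hinv : evalFrac (complexCoords p) (hU p hp) (IsLocalization.Away.invSelf (detPoly m n)) =
      ((matXY (complexCoords p)).det)⁻¹ := by
    apply eq_inv_of_mul_eq_one_right
    rw [← eval_detPoly, ← evalFrac_algebraMap _ (hU p hp), ← map_mul,
      IsLocalization.Away.mul_invSelf, map_one]
  induction f using Localization.induction_on with | _ x =>
  obtain ⟨a, t⟩ := x
  have h1 := (hasDerivAt_frac (hU p hp) w a t).mul (hF.hasDerivAt_line hp w)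
  -- `g` is known only on `U`; since `U` is open, the line through `p` stays in `U` for small `z`.
  have heq : (fun z : 𝕜 => g (p + z • Pi.single w 1)) =ᶠ[𝓝 0] fun z : 𝕜 =>
      (MvPolynomial.eval (complexCoords (p + z • Pi.single w 1)) a /
        MvPolynomial.eval (complexCoords (p + z • Pi.single w 1)) (t : MvPolynomial _ ℂ)) *
      F (p + z • Pi.single w 1) := by
    filter_upwards [hline.eventually (hUo.mem_nhds hp)] with z hz
    rw [hfg _ hz, evalFrac_mk]
  refine ((h1.congr_of_eventuallyEq heq).deriv).trans ?_
  simp only [zero_smul, add_zero, map_add, map_mul, hinv, fracDeriv_algebraMap,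
    evalFrac_algebraMap, MvPolynomial.eval_C]
  rw [evalFrac_mk _ _ a t]
  ring

/-- Locally `F` is a holomorphic function of the polynomial `P`, with scalars restricted to `𝕜`. -/
theorem IsPowBranch.contDiffOn
    (hF : IsPowBranch (fun p => (matXY (complexCoords p)).det) s U F) :
    ContDiffOn 𝕜 (⊤ : ℕ∞) F U := by
  intro p hp
  obtain ⟨-, h, hh, -, heq⟩ := hF.exists_eventuallyEq_comp hp
  have h1 : ContDiffAt 𝕜 (⊤ : ℕ∞) (fun p : Vars m n → 𝕜 => (matXY (complexCoords p)).det) p := by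
    have := contDiff_eval (𝕜 := 𝕜) (detPoly m n)
    simp only [eval_detPoly] at this
    exact this.contDiffAt
  exact (((hh.restrict_scalars 𝕜).comp p h1).congr_of_eventuallyEq heq).contDiffWithinAt

/-- The identity for a branch of a complex power. -/
theorem IsPowBranch.opDet_partialDeriv {k : ℕ} (hUo : IsOpen U)
    (hF : IsPowBranch (fun p => (matXY (complexCoords p)).det) s U F)
    (I J : Finset (Fin m)) (hI : I.card = k) (hJ : J.card = k) {p : Vars m n → 𝕜} (hp : p ∈ U) :
    opDet (submat (opXY (partialDeriv 𝕜)) I J hI hJ) F p =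
      factor s m n k * (F p / (matXY (complexCoords p)).det) *
        ((eps₂ I J : ℤ) * (subCompl (matXY (complexCoords p)) I J hI hJ).det) := by
  have hU : ∀ p ∈ U, (matXY (complexCoords p)).det ≠ 0 :=
    fun p hp => (hF.exists_eventuallyEq_comp hp).1
  let A := Localization.Away (detPoly m n)
  let D : Vars m n → A → A := fun w =>
    fracDeriv (Submonoid.powers (detPoly m n)) (MvPolynomial.pderiv w)
  let v : Vars m n → A := fun w => algebraMap (MvPolynomial (Vars m n) ℂ) A (MvPolynomial.X w)
  let sA : A := algebraMap (MvPolynomial (Vars m n) ℂ) A (MvPolynomial.C s)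
  let Pinv : A := IsLocalization.Away.invSelf (detPoly m n)
  have hadd : ∀ w f g, D w (f + g) = D w f + D w g := fun w => fracDeriv_add _ _
  have hmul : ∀ w f g, D w (f * g) = f * D w g + g * D w f := fun w => fracDeriv_mul _ _
  have hX : ∀ w w', D w (v w') = if w = w' then 1 else 0 := fun w w' => fracDeriv_pderiv_X _ w w'
  have hs : ∀ w, D w sA = 0 := by
    intro w
    refine (fracDeriv_algebraMap _ _ _).trans ?_
    rw [MvPolynomial.pderiv_C, map_zero]
  have hdet : (matXY v).det = algebraMap (MvPolynomial (Vars m n) ℂ) A (detPoly m n) :=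
    (map_det_matXY _ _).symm
  have hPinv : (matXY v).det * Pinv = 1 := by
    rw [hdet]
    exact IsLocalization.Away.mul_invSelf _
  have key := opDet_submat_formalPow hadd hmul hX hs hPinv I J hI hJ
  have hone : ((1 : A), F) ∈ fracMulRel hU F := by
    rw [mem_fracMulRel]
    intro p hp
    rw [map_one, one_mul]
  -- A relation is used in place of a map because functions are compared on `U` only; starting from
  -- the pair `(1, F)`, it is preserved by each derivative.
  have hrel := opDet_opXY_rel (fracMulRel hU F)
    (fun w f => D w f + sA * f * D w (matXY v).det * Pinv) (partialDeriv 𝕜)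
    (fun w x hx => by
      rw [hdet]
      exact partialDeriv_mem_fracMulRel hUo hF hU w hx)
    (I.orderEmbOfFin hI) (J.orderEmbOfFin hJ) hone
  have hval := mem_fracMulRel.1 hrel p hp
  have hev : ∀ a, evalFrac (complexCoords p) (hU p hp)
      (algebraMap (MvPolynomial (Vars m n) ℂ) A a) =
      MvPolynomial.eval (complexCoords p) a := evalFrac_algebraMap _ _
  have hinv : evalFrac (complexCoords p) (hU p hp) Pinv =
      ((matXY (complexCoords p)).det)⁻¹ := by
    apply eq_inv_of_mul_eq_one_right
    have h := congrArg (evalFrac (complexCoords p) (hU p hp)) hPinv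
    rw [map_mul, map_one, hdet, hev, eval_detPoly] at h
    exact h
  have hval' := congrArg (evalFrac (complexCoords p) (hU p hp)) key
  refine hval.trans ((congrArg (· * F p) hval').trans ?_)
  simp only [map_mul, map_factor, map_intCast, map_det_subCompl, hinv]
  have hvv : (fun w => evalFrac (complexCoords p) (hU p hp) (v w)) = complexCoords p := by
    funext w
    rw [hev, MvPolynomial.eval_X]
  rw [hvv, hev, MvPolynomial.eval_C]
  ring

end Analytic

end RectCayley

/-! ### The theorem in all its versions -/

theorem theorem2p6 (m n : ℕ) (hmn : m ≤ n) :
    -- integers `s ≥ 1`, in the polynomial ring over an arbitrary commutative ring `R`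
    (∀ (R : Type*) [CommRing R] (s : ℕ), 1 ≤ s →
      let D : Vars m n → MvPolynomial (Vars m n) R → MvPolynomial (Vars m n) R :=
        fun w f => MvPolynomial.pderiv w f
      let Z : Matrix (Fin m) (Fin m) (MvPolynomial (Vars m n) R) := matXY MvPolynomial.X
      opDet (opXY D) (Z.det ^ s) =
        factor (s : MvPolynomial (Vars m n) R) m n m * Z.det ^ (s - 1) ∧
      ∀ (k : ℕ) (I J : Finset (Fin m)) (hI : I.card = k) (hJ : J.card = k),
        opDet (submat (opXY D) I J hI hJ) (Z.det ^ s) =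
          factor (s : MvPolynomial (Vars m n) R) m n k * Z.det ^ (s - 1) *
            ((eps₂ I J : ℤ) * (subCompl Z I J hI hJ).det)) ∧
    -- arbitrary integers `s`, in the field of rational fractions over an arbitrary field `K`
    (∀ (K : Type*) [Field K] (s : ℤ),
      let F := FractionRing (MvPolynomial (Vars m n) K)
      let D : Vars m n → F → F :=
        fun w => fracDeriv (nonZeroDivisors (MvPolynomial (Vars m n) K)) (MvPolynomial.pderiv w)
      let Z : Matrix (Fin m) (Fin m) F :=
        matXY fun w => algebraMap (MvPolynomial (Vars m n) K) F (MvPolynomial.X w)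
      opDet (opXY D) (Z.det ^ s) = factor (s : F) m n m * Z.det ^ (s - 1) ∧
      ∀ (k : ℕ) (I J : Finset (Fin m)) (hI : I.card = k) (hJ : J.card = k),
        opDet (submat (opXY D) I J hI hJ) (Z.det ^ s) =
          factor (s : F) m n k * Z.det ^ (s - 1) *
            ((eps₂ I J : ℤ) * (subCompl Z I J hI hJ).det)) ∧
    -- `s` an indeterminate, in the module `K[x, y, s, P⁻¹] P ^ s` with `P = det (X Yᵀ)`;
    -- `1` represents `P ^ s`, and `P⁻¹` represents `P ^ (s - 1)`
    (∀ (K : Type*) [Field K] [CharZero K],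
      let Z : Matrix (Fin m) (Fin m) (SymRing K m n) :=
        matXY fun w => toSym K m n (MvPolynomial.X w)
      opDet (opXY (symDeriv K m n)) 1 = factor (symS K m n) m n m * symPInv K m n ∧
      ∀ (k : ℕ) (I J : Finset (Fin m)) (hI : I.card = k) (hJ : J.card = k),
        opDet (submat (opXY (symDeriv K m n)) I J hI hJ) 1 =
          factor (symS K m n) m n k * symPInv K m n *
            ((eps₂ I J : ℤ) * (subCompl Z I J hI hJ).det)) ∧
    -- complex `s`, for a branch `F` of `det (X Yᵀ) ^ s` on an open set of real variables;
    -- the corresponding branch of `det (X Yᵀ) ^ (s - 1)` is `F / det (X Yᵀ)`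
    (∀ (s : ℂ) (U : Set (Vars m n → ℝ)) (F : (Vars m n → ℝ) → ℂ), IsOpen U →
      let Z : (Vars m n → ℝ) → Matrix (Fin m) (Fin m) ℂ := fun p => matXY fun w => (p w : ℂ)
      IsPowBranch (fun p => (Z p).det) s U F →
      ContDiffOn ℝ (⊤ : ℕ∞) F U ∧
      (∀ p ∈ U, opDet (opXY (partialDeriv ℝ)) F p = factor s m n m * (F p / (Z p).det)) ∧
      ∀ (k : ℕ) (I J : Finset (Fin m)) (hI : I.card = k) (hJ : J.card = k), ∀ p ∈ U,
        opDet (submat (opXY (partialDeriv ℝ)) I J hI hJ) F p =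
          factor s m n k * (F p / (Z p).det) *
            ((eps₂ I J : ℤ) * (subCompl (Z p) I J hI hJ).det)) ∧
    -- the same for complex variables
    (∀ (s : ℂ) (U : Set (Vars m n → ℂ)) (F : (Vars m n → ℂ) → ℂ), IsOpen U →
      let Z : (Vars m n → ℂ) → Matrix (Fin m) (Fin m) ℂ := fun p => matXY p
      IsPowBranch (fun p => (Z p).det) s U F →
      ContDiffOn ℂ (⊤ : ℕ∞) F U ∧
      (∀ p ∈ U, opDet (opXY (partialDeriv ℂ)) F p = factor s m n m * (F p / (Z p).det)) ∧
      ∀ (k : ℕ) (I J : Finset (Fin m)) (hI : I.card = k) (hJ : J.card = k), ∀ p ∈ U,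
        opDet (submat (opXY (partialDeriv ℂ)) I J hI hJ) F p =
          factor s m n k * (F p / (Z p).det) *
            ((eps₂ I J : ℤ) * (subCompl (Z p) I J hI hJ).det)) := by
  refine ⟨?_, ?_, ?_, ?_, ?_⟩
  · intro R _ s hs D Z
    have key : ∀ (k : ℕ) (I J : Finset (Fin m)) (hI : I.card = k) (hJ : J.card = k),
        opDet (submat (opXY D) I J hI hJ) (Z.det ^ s) =
          factor (s : MvPolynomial (Vars m n) R) m n k * Z.det ^ (s - 1) *
            ((eps₂ I J : ℤ) * (subCompl Z I J hI hJ).det) :=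
      fun k I J hI hJ => opDet_pow R hmn s hs I J hI hJ
    refine ⟨?_, key⟩
    -- The first identity is the minor identity at `I = J = [m]`; the other versions repeat this.
    have := key m _ _ (Finset.card_fin m) (Finset.card_fin m)
    rwa [submat_univ, eps₂_mul_det_subCompl_univ, mul_one] at this
  · intro K _ s F D Z
    have key : ∀ (k : ℕ) (I J : Finset (Fin m)) (hI : I.card = k) (hJ : J.card = k),
        opDet (submat (opXY D) I J hI hJ) (Z.det ^ s) =
          factor (s : F) m n k * Z.det ^ (s - 1) *
            ((eps₂ I J : ℤ) * (subCompl Z I J hI hJ).det) :=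
      fun k I J hI hJ => opDet_zpow K hmn s I J hI hJ
    refine ⟨?_, key⟩
    have := key m _ _ (Finset.card_fin m) (Finset.card_fin m)
    rwa [submat_univ, eps₂_mul_det_subCompl_univ, mul_one] at this
  · intro K _ _ Z
    have key := fun k I J hI hJ => opDet_symDeriv K (m := m) (n := n) (k := k) I J hI hJ
    refine ⟨?_, key⟩
    have := key m _ _ (Finset.card_fin m) (Finset.card_fin m)
    rwa [submat_univ, eps₂_mul_det_subCompl_univ, mul_one] at this
  · intro s U F hU Z hF
    have key := fun k I J hI hJ p hp =>
      IsPowBranch.opDet_partialDeriv (𝕜 := ℝ) (m := m) (n := n) (k := k) hU hF I J hI hJ (p := p) hp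
    refine ⟨IsPowBranch.contDiffOn (𝕜 := ℝ) hF, fun p hp => ?_, key⟩
    have := key m _ _ (Finset.card_fin m) (Finset.card_fin m) p hp
    rwa [submat_univ, eps₂_mul_det_subCompl_univ, mul_one] at this
  · intro s U F hU Z hF
    have key := fun k I J hI hJ p hp =>
      IsPowBranch.opDet_partialDeriv (𝕜 := ℂ) (m := m) (n := n) (k := k) hU hF I J hI hJ (p := p) hp
    refine ⟨IsPowBranch.contDiffOn (𝕜 := ℂ) hF, fun p hp => ?_, key⟩
    have := key m _ _ (Finset.card_fin m) (Finset.card_fin m) p hp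
    rwa [submat_univ, eps₂_mul_det_subCompl_univ, mul_one] at this
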